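/- For $\ell>0$, $\lambda\ge 0$ and $r>0$ consider the following one-dimensional Boolean model on the segment $[0,\ell]$. Let $N$ be a Poisson random variable with parameter $\lambda\ell$, let $U_1,U_2,\dots$ be i.i.d. uniform on $[0,\ell]$, and let $E_0,E_1,\dots$ be i.i.d. exponential with parameter $1$, all independent. The $N$ internal points $U_1,\dots,U_N$ cover the intervals $[U_j-\tfrac r2E_j,\;U_j+\tfrac r2E_j]$, $1\le j\le N$, and the two endpoints $0$ and $\ell$ of the segment cover $[-rE_0,\,rE_0]$ and $[\ell-rE_{N+1},\,\ell+rE_{N+1}]$. Let $\mathbf p(\ell,\lambda,r)$ be the probability that the union of these $N+2$ intervals contains $[0,\ell]$. Then: (i) for all $\ell>0$, $\lambda\ge0$, $r>0$ the partial derivatives $\partial_\lambda\mathbf p(\ell,\lambda,r)$ (the right derivative when $\lambda=0$) and $\partial_r\mathbf p(\ell,\lambda,r)$ exist and are strictly positive; (ii) for all $\lambda\ge0$ and $r>0$, $$\max\Big\{\sup_{\ell>0}\partial_\lambda\mathbf p(\ell,\lambda,r),\ \sup_{\ell>0}\partial_r\mathbf p(\ell,\lambda,r)\Big\}<+\infty;$$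 (iii) there is a continuous map $C:(0,+\infty)\to(0,+\infty)$, depending neither on $\ell$ nor on $\lambda$, such that for all $\ell>0$, $\lambda\ge0$, $r>0$, $$\partial_\lambda\mathbf p(\ell,\lambda,r)\le C(r)\,e^{\lambda r/2}\,\partial_r\mathbf p(\ell,\lambda,r).$$ -/

import Mathlib

open Set MeasureTheory ProbabilityTheory

namespace SegmentModel

/-- The sample space: the number `N` of internal points, a sequence of locations and a sequence of
ranges. With `N` internal points, only the locations of index `1, …, N` and the ranges of index
`0, …, N + 1` are used. -/
abbrev Sample : Type := ℕ × (ℕ → ℝ) × (ℕ → ℝ)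

/-- The law of the model: `N` is Poisson with parameter `lam * ℓ`, the locations are i.i.d. uniform
on `[0, ℓ]`, the ranges are i.i.d. exponential with parameter `1`, and the three are independent. -/
noncomputable def law (ℓ lam : ℝ) : Measure Sample :=
  (poissonMeasure (lam * ℓ).toNNReal).prod
    ((Measure.infinitePi fun _ : ℕ => (volume : Measure ℝ)[|Icc 0 ℓ]).prod
      (Measure.infinitePi fun _ : ℕ => expMeasure 1))

/-- The `j`-th point, `0 ≤ j ≤ N + 1`: the left end of the segment, an internal point, or the right
end. -/
noncomputable def point (ℓ : ℝ) (ω : Sample) (j : ℕ) : ℝ :=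
  if j = 0 then 0 else if j = ω.1 + 1 then ℓ else ω.2.1 j

/-- The radius around the `j`-th point: `(r / 2) * E_j` at an internal point, `r * E_j` at the two
ends of the segment. -/
noncomputable def radius (r : ℝ) (ω : Sample) (j : ℕ) : ℝ :=
  if j = 0 ∨ j = ω.1 + 1 then r * ω.2.2 j else r / 2 * ω.2.2 j

/-- The region covered by the `N + 2` intervals centred at the points. -/
noncomputable def covered (ℓ r : ℝ) (ω : Sample) : Set ℝ :=
  ⋃ j ∈ Finset.range (ω.1 + 2),
    Icc (point ℓ ω j - radius r ω j) (point ℓ ω j + radius r ω j)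

/-- The probability that the segment `[0, ℓ]` is entirely covered. -/
noncomputable def coverProb (ℓ lam r : ℝ) : ℝ :=
  (law ℓ lam).real {ω | Icc 0 ℓ ⊆ covered ℓ r ω}

/-- The partial derivative with respect to the intensity, whose range is `[0, ∞)`: it is the
two-sided derivative at `lam > 0` and the right derivative at `lam = 0`. -/
noncomputable def partialLam (ℓ lam r : ℝ) : ℝ :=
  derivWithin (fun s => coverProb ℓ s r) (Ici 0) lam

/-- The partial derivative with respect to the radius parameter. -/
noncomputable def partialR (ℓ lam r : ℝ) : ℝ :=
  deriv (fun s => coverProb ℓ lam s) r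

end SegmentModel

/-!
# Derivatives of the covering probability of a segment

Conditionally on `N = n` the model consists of `n + 2` independent balls, and the covering
probability is a Poisson mixture of numbers `q n r = coverProbGiven ℓ n r`. When the balls of a
configuration leave a part of `[0, ℓ]` uncovered, only the hull `[a, b]` of that part matters: a
ball centred at `x` completes the covering if and only if its radius is at least
`max (x - a) (b - x) = (b - a) / 2 + |x - (a + b) / 2|` (`subset_union_interval_iff`, `reach_eq`).

* The derivative of the mixture in `lam` is the Poisson mean of `ℓ * (q (n + 1) r - q n r)`, where
  the difference is the probability that a new point completes the covering. Integrating over its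
  position bounds `ℓ * (q (n + 1) r - q n r)` by `r * E[exp (-(b - a) / r); not covered]`
  (`lintegral_completing_le`), hence by `r`.
* Changing `r` tilts the law of the radii exponentially (`cfgLaw_eq_withDensity`), so `q n` is
  differentiable and its derivative is the mean of a score. Conditioning the `j`-th term of the
  score on the other balls turns it into the influence of the `j`-th ball, the mean of
  `u * exp (-u)`, where `u` is the normalized radius with which that ball completes the covering
  (`setIntegral_score`, `hasDerivAt_covered`). The influence is at most `1`, and of order `r / ℓ`
  for an internal point, which bounds the Poisson mean uniformly in `ℓ`
  (`coverProbGivenDeriv_le'`).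
* The two derivatives are compared for each `n`. If the segment is not covered, the left end `a`
  of the hull is the right end of some ball. Without that ball the hull is `[a', b]` with
  `a' ≤ a`, and the ball starts to the left of `a'` (`exists_left_neighbour`). With the other
  balls and the left end of this one fixed (for the end `0`, its centre), the density of its right
  end at `a` times `exp (-(b - a) / r)` does not depend on `a`, so integrating over `a ∈ [a', b]`
  produces the factor `b - a'` and, after integrating the left end over `(-∞, a']`, the decay
  `exp (-(b - a') / r)`, which are also those of the influence. Hence
  `E[exp (-(b - a) / r); not covered]` is at most twice the sum of the influences
  (`leftover_le_sum_modelInfluence`), and `ℓ * (q (n + 1) r - q n r) ≤ 2 * r ^ 2 * deriv (q n) r`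
  (`mul_coverProbGiven_sub_le_deriv`).

Averaging over `n` gives the comparison of the partial derivatives with the constant `2 * r ^ 2`.
The derivative in `lam` is positive because `q 0 r < q 1 r`, and the comparison then makes the
derivative in `r` positive as well.
-/

namespace SegmentModel

/-! ### Exponential laws -/

lemma expMeasure_eq_withDensity (c : ℝ) :
    expMeasure c = (volume.restrict (Ioi (0 : ℝ))).withDensity
      (fun x => ENNReal.ofReal (c * Real.exp (-(c * x)))) := by
  rw [restrict_Ioi_eq_restrict_Ici, ← withDensity_indicator measurableSet_Ici]
  change volume.withDensity (exponentialPDF c) = _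
  congr 1
  ext x
  by_cases hx : 0 ≤ x
  · simp [exponentialPDF_eq, hx]
  · simp [exponentialPDF_eq, hx]

lemma lintegral_expMeasure {c : ℝ} {f : ℝ → ENNReal} (hf : Measurable f) :
    ∫⁻ s, f s ∂expMeasure c
      = ∫⁻ s in Ioi (0 : ℝ), ENNReal.ofReal (c * Real.exp (-(c * s))) * f s := by
  rw [expMeasure_eq_withDensity, lintegral_withDensity_eq_lintegral_mul _ (by fun_prop) hf]
  rfl

lemma integral_expMeasure {c : ℝ} (hc : 0 ≤ c) (f : ℝ → ℝ) :
    ∫ s, f s ∂expMeasure c = ∫ s in Ioi (0 : ℝ), c * Real.exp (-(c * s)) * f s := by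
  rw [expMeasure_eq_withDensity, integral_withDensity_eq_integral_toReal_smul (by fun_prop)
    (Filter.Eventually.of_forall fun _ => ENNReal.ofReal_lt_top)]
  refine integral_congr_ae (Filter.Eventually.of_forall fun s => ?_)
  simp only [smul_eq_mul]
  rw [ENNReal.toReal_ofReal (by positivity)]

lemma integrable_id_expMeasure {c : ℝ} (hc : 0 < c) :
    Integrable (fun s : ℝ => s) (expMeasure c) := by
  rw [expMeasure_eq_withDensity, integrable_withDensity_iff_integrable_smul' (by fun_prop)
    (Filter.Eventually.of_forall fun _ => ENNReal.ofReal_lt_top)]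
  have h2 : IntegrableOn (fun x : ℝ => x ^ (1 : ℝ) * Real.exp (-c * x)) (Ioi 0) :=
    integrableOn_rpow_mul_exp_neg_mul_rpow (p := 1) (s := 1) (b := c) (by norm_num) (by norm_num) hc
      |>.congr_fun (fun x hx => by simp) measurableSet_Ioi
  refine (h2.const_mul c).congr ?_
  refine Filter.Eventually.of_forall fun s => ?_
  simp only [smul_eq_mul]
  rw [ENNReal.toReal_ofReal (by positivity), Real.rpow_one]
  ring_nf

lemma ae_pos_expMeasure (c : ℝ) : ∀ᵐ s ∂expMeasure c, 0 < s := by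
  rw [expMeasure_eq_withDensity]
  exact (withDensity_absolutelyContinuous _ _).ae_le (ae_restrict_mem measurableSet_Ioi)

lemma expMeasure_Ici {c t : ℝ} (hc : 0 < c) (ht : 0 ≤ t) :
    expMeasure c (Ici t) = ENNReal.ofReal (Real.exp (-(c * t))) := by
  have := isProbabilityMeasure_expMeasure hc
  have h0 : expMeasure c (Ici t) = expMeasure c (Ioi t) := by
    have : expMeasure c ≪ volume := by
      rw [expMeasure_eq_withDensity]
      exact (withDensity_absolutelyContinuous _ _).trans Measure.absolutelyContinuous_restrict
    exact measure_congr (this.ae_eq Ioi_ae_eq_Ici.symm)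
  have h1 := cdf_expMeasure_eq hc t
  rw [cdf_eq_real, if_pos ht] at h1
  rw [h0, ← compl_Iic, ← ofReal_measureReal, measureReal_compl measurableSet_Iic, h1]
  simp

/-- The mean of `c * s - 1` over `s ≥ t` under the exponential law of rate `c`. -/
lemma setIntegral_expMeasure_Ici {c t : ℝ} (hc : 0 < c) (ht : 0 ≤ t) :
    ∫ s in Ici t, (c * s - 1) ∂expMeasure c = c * t * Real.exp (-(c * t)) := by
  have hint : Integrable (fun s : ℝ => c * s - 1) (expMeasure c) := by
    have := isProbabilityMeasure_expMeasure hc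
    exact ((integrable_id_expMeasure hc).const_mul c).sub (integrable_const 1)
  rw [← integral_indicator measurableSet_Ici, integral_expMeasure hc.le]
  have e1 : ∀ s : ℝ, c * Real.exp (-(c * s)) * (Ici t).indicator (fun s => c * s - 1) s
      = (Ici t).indicator (fun s => c * Real.exp (-(c * s)) * (c * s - 1)) s := by
    intro s; by_cases h : s ∈ Ici t <;> simp [h]
  simp_rw [e1]
  rw [integral_indicator measurableSet_Ici, Measure.restrict_restrict measurableSet_Ici,
    restrict_Ioi_eq_restrict_Ici (a := (0:ℝ)) |> fun h => (by
      rw [← Measure.restrict_restrict measurableSet_Ici, h,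
        Measure.restrict_restrict measurableSet_Ici] :
      volume.restrict (Ici t ∩ Ioi (0:ℝ)) = volume.restrict (Ici t ∩ Ici 0)),
    Ici_inter_Ici, sup_eq_left.2 ht, integral_Ici_eq_integral_Ioi]
  have hI : IntegrableOn (fun s => c * Real.exp (-(c * s)) * (c * s - 1)) (Ioi t) := by
    rw [expMeasure_eq_withDensity, integrable_withDensity_iff_integrable_smul' (by fun_prop)
      (Filter.Eventually.of_forall fun _ => ENNReal.ofReal_lt_top)] at hint
    refine IntegrableOn.mono_set (t := Ioi 0) (hint.congr ?_) (Ioi_subset_Ioi ht)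
    refine Filter.Eventually.of_forall fun s => ?_
    simp only [smul_eq_mul]
    rw [ENNReal.toReal_ofReal (by positivity)]
  have hd : ∀ s ∈ Ici t, HasDerivAt (fun s => -(c * s * Real.exp (-(c * s))))
      (c * Real.exp (-(c * s)) * (c * s - 1)) s := by
    intro s _
    have h1 : HasDerivAt (fun s => c * s) c s := by simpa using (hasDerivAt_id s).const_mul c
    refine (h1.fun_mul h1.fun_neg.exp).fun_neg.congr_deriv ?_
    ring
  have hl : Filter.Tendsto (fun s => -(c * s * Real.exp (-(c * s)))) Filter.atTop (nhds 0) := by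
    have h2 := (Real.tendsto_pow_mul_exp_neg_atTop_nhds_zero 1).comp
      (Filter.tendsto_id.const_mul_atTop hc)
    simpa [Function.comp_def] using h2.neg
  rw [integral_Ioi_of_hasDerivAt_of_tendsto' hd hI hl]
  ring

/-! ### Uncovered parts of the segment -/

/-- The interval covered by a ball, given as the pair of its centre and its radius. -/
def interval (z : ℝ × ℝ) : Set ℝ := Icc (z.1 - z.2) (z.1 + z.2)

/-- The region covered by a finite family of balls. -/
def region {m : ℕ} (ω : Fin m → ℝ × ℝ) : Set ℝ := ⋃ i, interval (ω i)

/-- The part of the segment `[0, ℓ]` left uncovered by `K`. -/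
def gap (ℓ : ℝ) (K : Set ℝ) : Set ℝ := Icc 0 ℓ \ K

/-- The left end of the hull of the uncovered part. -/
noncomputable def gapInf (ℓ : ℝ) (K : Set ℝ) : ℝ := sInf (gap ℓ K)

/-- The right end of the hull of the uncovered part. -/
noncomputable def gapSup (ℓ : ℝ) (K : Set ℝ) : ℝ := sSup (gap ℓ K)

/-- The least radius with which a ball centred at `x` covers everything that `K` leaves
uncovered. -/
noncomputable def reach (ℓ : ℝ) (K : Set ℝ) (x : ℝ) : ℝ :=
  max (x - gapInf ℓ K) (gapSup ℓ K - x)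

section Geometry

variable {ℓ : ℝ} {K : Set ℝ}

lemma bddBelow_gap : BddBelow (gap ℓ K) := ⟨0, fun _ h => h.1.1⟩

lemma bddAbove_gap : BddAbove (gap ℓ K) := ⟨ℓ, fun _ h => h.1.2⟩

lemma gapInf_nonneg : 0 ≤ gapInf ℓ K := Real.sInf_nonneg fun _ h => h.1.1

lemma gapInf_le_gapSup : gapInf ℓ K ≤ gapSup ℓ K :=
  Real.sInf_le_sSup _ bddBelow_gap bddAbove_gap

lemma gapSup_le (hℓ : 0 ≤ ℓ) : gapSup ℓ K ≤ ℓ := Real.sSup_le (fun _ h => h.1.2) hℓ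

lemma reach_eq (x : ℝ) : reach ℓ K x
    = (gapSup ℓ K - gapInf ℓ K) / 2 + |x - (gapInf ℓ K + gapSup ℓ K) / 2| := by
  rw [reach, max_def]
  split_ifs with h
  · rw [abs_of_nonpos (by linarith)]; ring
  · rw [abs_of_nonneg (by linarith)]; ring

lemma reach_nonneg (x : ℝ) : 0 ≤ reach ℓ K x := by
  rw [reach_eq]
  have := gapInf_le_gapSup (ℓ := ℓ) (K := K)
  have := abs_nonneg (x - (gapInf ℓ K + gapSup ℓ K) / 2)
  linarith

lemma subset_iff_not_gap_nonempty : Icc 0 ℓ ⊆ K ↔ ¬ (gap ℓ K).Nonempty := by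
  rw [gap, not_nonempty_iff_eq_empty, sdiff_eq_empty]

lemma subset_union_interval_iff (h : (gap ℓ K).Nonempty) (x s : ℝ) :
    Icc 0 ℓ ⊆ K ∪ interval (x, s) ↔ reach ℓ K x ≤ s := by
  rw [← sdiff_subset_iff, reach, max_le_iff]
  change gap ℓ K ⊆ Icc (x - s) (x + s) ↔ _
  constructor
  · intro hs
    have h1 : x - s ≤ gapInf ℓ K := le_csInf h fun v hv => (hs hv).1
    have h2 : gapSup ℓ K ≤ x + s := csSup_le h fun v hv => (hs hv).2
    constructor <;> linarith
  · rintro ⟨h1, h2⟩ v hv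
    have h3 : gapInf ℓ K ≤ v := csInf_le bddBelow_gap hv
    have h4 : v ≤ gapSup ℓ K := le_csSup bddAbove_gap hv
    constructor <;> linarith

end Geometry

section Region

variable {m : ℕ}

lemma region_eq_union (ω : Fin (m + 1) → ℝ × ℝ) (j : Fin (m + 1)) :
    region ω = region (fun i => ω (j.succAbove i)) ∪ interval (ω j) := by
  ext v
  simp only [region, mem_iUnion, mem_union,
    Fin.exists_iff_succAbove j (P := fun i => v ∈ interval (ω i))]
  exact or_comm

/-- The ball whose right end is the left end of the hull of the uncovered part: without it, the
uncovered part may extend further to the left, but not beyond the left end of that ball and not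
further to the right. -/
lemma exists_left_neighbour {ℓ : ℝ} (ω : Fin (m + 1) → ℝ × ℝ)
    (hω : (gap ℓ (region ω)).Nonempty) (h0 : 0 ∈ region ω) :
    ∃ j : Fin (m + 1), (gap ℓ (region fun i => ω (j.succAbove i))).Nonempty ∧
      gapSup ℓ (region fun i => ω (j.succAbove i)) = gapSup ℓ (region ω) ∧
      (ω j).1 + (ω j).2 = gapInf ℓ (region ω) ∧
      (ω j).1 - (ω j).2 ≤ gapInf ℓ (region fun i => ω (j.succAbove i)) ∧
      gapInf ℓ (region fun i => ω (j.succAbove i)) ≤ (ω j).1 + (ω j).2 := by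
  set a := gapInf ℓ (region ω) with ha
  have hcl : IsClosed (region ω) := isClosed_iUnion_of_finite fun i => isClosed_Icc
  have haK : a ∈ region ω := by
    by_contra hcon
    obtain ⟨v, hv⟩ := hω
    have hav : a ≤ v := csInf_le bddBelow_gap hv
    have ha0 : 0 ≤ a := gapInf_nonneg
    have ha0' : a ≠ 0 := fun h => hcon (h ▸ h0)
    obtain ⟨ε, hε, hb⟩ := Metric.isOpen_iff.1 hcl.isOpen_compl a hcon
    have hmin : 0 < min ε a := lt_min hε (lt_of_le_of_ne ha0 (Ne.symm ha0'))
    have : a - min ε a / 2 ∈ gap ℓ (region ω) := by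
      refine ⟨⟨?_, ?_⟩, hb ?_⟩
      · have := min_le_right ε a; linarith
      · linarith [hv.1.2]
      · rw [Metric.mem_ball, Real.dist_eq, abs_lt]
        have := min_le_left ε a
        constructor <;> linarith
    have := csInf_le bddBelow_gap this
    change a ≤ _ at this
    linarith
  obtain ⟨j, hj⟩ := mem_iUnion.1 haK
  have hga : ∀ v ∈ gap ℓ (region ω), a ≤ v := fun v hv => csInf_le bddBelow_gap hv
  have hβ : (ω j).1 + (ω j).2 = a := by
    refine le_antisymm ?_ hj.2
    refine le_csInf hω fun v hv => ?_
    by_contra hcon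
    exact hv.2 (mem_iUnion.2 ⟨j, hj.1.trans (hga v hv), (not_le.1 hcon).le⟩)
  have hsub : gap ℓ (region ω) ⊆ gap ℓ (region fun i => ω (j.succAbove i)) := by
    intro v hv
    refine ⟨hv.1, fun h => hv.2 ?_⟩
    rw [region_eq_union ω j]
    exact Or.inl h
  have hdiff : ∀ v ∈ gap ℓ (region fun i => ω (j.succAbove i)), v ∉ interval (ω j) →
      v ∈ gap ℓ (region ω) := by
    intro v hv hvj
    refine ⟨hv.1, ?_⟩
    rw [region_eq_union ω j]
    exact fun h => h.elim hv.2 hvj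
  have hb : a ≤ gapSup ℓ (region ω) := gapInf_le_gapSup
  have hne := hω.mono hsub
  refine ⟨j, hne, ?_, hβ, ?_, ?_⟩
  · refine le_antisymm (csSup_le hne fun v hv => ?_) (csSup_le_csSup bddAbove_gap hω hsub)
    by_cases h : v ∈ interval (ω j)
    · exact (h.2.trans hβ.le).trans hb
    · exact le_csSup bddAbove_gap (hdiff v hv h)
  · refine le_csInf hne fun v hv => ?_
    by_contra hcon
    have h1 := hga v (hdiff v hv fun h => hcon h.1)
    have h2 := hj.1
    linarith
  · rw [hβ]
    exact csInf_le_csInf bddBelow_gap hω hsub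

end Region

section Measurability

lemma measurableSet_mem_region {m : ℕ} (v : ℝ) :
    MeasurableSet {ω : Fin m → ℝ × ℝ | v ∈ region ω} := by
  have : {ω : Fin m → ℝ × ℝ | v ∈ region ω}
      = ⋃ i, {ω | (ω i).1 - (ω i).2 ≤ v} ∩ {ω | v ≤ (ω i).1 + (ω i).2} := by
    ext ω; simp [region, interval]
  rw [this]
  exact MeasurableSet.iUnion fun i =>
    (measurableSet_le (by fun_prop) measurable_const).inter
      (measurableSet_le measurable_const (by fun_prop))

lemma isClosed_region {m : ℕ} (ω : Fin m → ℝ × ℝ) : IsClosed (region ω) :=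
  isClosed_iUnion_of_finite fun _ => isClosed_Icc

lemma exists_rat_of_isOpen {ℓ : ℝ} (hℓ : 0 < ℓ) {O : Set ℝ} (hO : IsOpen O) {v : ℝ}
    (hv : v ∈ Icc 0 ℓ) (hvO : v ∈ O) : ∃ q : ℚ, (q : ℝ) ∈ Icc 0 ℓ ∩ O := by
  rw [← closure_Ioo hℓ.ne] at hv
  obtain ⟨w, hw⟩ := mem_closure_iff.1 hv O hO hvO
  obtain ⟨y, hy, q, rfl⟩ := (Rat.denseRange_cast (𝕜 := ℝ)).inter_open_nonempty _
    (hO.inter isOpen_Ioo) ⟨w, hw⟩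
  exact ⟨q, Ioo_subset_Icc_self hy.2, hy.1⟩

variable {Ω : Type*} [MeasurableSpace Ω] {K : Ω → Set ℝ} {ℓ : ℝ}

/-- Because the covered region is closed, only rational points of the segment need be tested. -/
lemma measurableSet_exists_gap (hℓ : 0 < ℓ) (hK : ∀ ω, IsClosed (K ω))
    (hm : ∀ v, MeasurableSet {ω | v ∈ K ω}) {O : Set ℝ} (hO : IsOpen O) :
    MeasurableSet {ω | (gap ℓ (K ω) ∩ O).Nonempty} := by
  have : {ω | (gap ℓ (K ω) ∩ O).Nonempty}
      = ⋃ q : ℚ, {ω | (q : ℝ) ∈ Icc 0 ℓ ∩ O ∧ (q : ℝ) ∉ K ω} := by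
    ext ω
    simp only [mem_ofPred_eq, mem_iUnion]
    constructor
    · rintro ⟨v, hv, hvO⟩
      obtain ⟨q, hq⟩ := exists_rat_of_isOpen hℓ ((hK ω).isOpen_compl.inter hO) hv.1 ⟨hv.2, hvO⟩
      exact ⟨q, ⟨hq.1, hq.2.2⟩, hq.2.1⟩
    · rintro ⟨q, ⟨h1, h2⟩, h3⟩
      exact ⟨q, ⟨h1, h3⟩, h2⟩
  rw [this]
  exact MeasurableSet.iUnion fun q => (MeasurableSet.const _).inter (hm q).compl

lemma measurableSet_gap_nonempty (hℓ : 0 < ℓ) (hK : ∀ ω, IsClosed (K ω))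
    (hm : ∀ v, MeasurableSet {ω | v ∈ K ω}) : MeasurableSet {ω | (gap ℓ (K ω)).Nonempty} := by
  simpa using measurableSet_exists_gap hℓ hK hm isOpen_univ

lemma measurable_gapSup (hℓ : 0 < ℓ) (hK : ∀ ω, IsClosed (K ω))
    (hm : ∀ v, MeasurableSet {ω | v ∈ K ω}) : Measurable fun ω => gapSup ℓ (K ω) := by
  refine measurable_of_Ioi fun c => ?_
  have : (fun ω => gapSup ℓ (K ω)) ⁻¹' Ioi c = {ω | (gap ℓ (K ω) ∩ Ioi c).Nonempty} ∪
      ({ω | (gap ℓ (K ω)).Nonempty}ᶜ ∩ {_ω | c < 0}) := by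
    ext ω
    by_cases h : (gap ℓ (K ω)).Nonempty
    · simp only [mem_preimage, mem_Ioi, gapSup, lt_csSup_iff bddAbove_gap h, mem_union,
        mem_ofPred_eq, mem_inter_iff, mem_compl_iff, h, not_true_eq_false, false_and, or_false]
      rfl
    · simp [gapSup, not_nonempty_iff_eq_empty.1 h]
  rw [this]
  exact (measurableSet_exists_gap hℓ hK hm isOpen_Ioi).union
    ((measurableSet_gap_nonempty hℓ hK hm).compl.inter (MeasurableSet.const _))

lemma measurable_gapInf (hℓ : 0 < ℓ) (hK : ∀ ω, IsClosed (K ω))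
    (hm : ∀ v, MeasurableSet {ω | v ∈ K ω}) : Measurable fun ω => gapInf ℓ (K ω) := by
  refine measurable_of_Iio fun c => ?_
  have : (fun ω => gapInf ℓ (K ω)) ⁻¹' Iio c = {ω | (gap ℓ (K ω) ∩ Iio c).Nonempty} ∪
      ({ω | (gap ℓ (K ω)).Nonempty}ᶜ ∩ {_ω | 0 < c}) := by
    ext ω
    by_cases h : (gap ℓ (K ω)).Nonempty
    · simp only [mem_preimage, mem_Iio, gapInf, csInf_lt_iff bddBelow_gap h, mem_union,
        mem_ofPred_eq, mem_inter_iff, mem_compl_iff, h, not_true_eq_false, false_and, or_false]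
      rfl
    · simp [gapInf, not_nonempty_iff_eq_empty.1 h]
  rw [this]
  exact (measurableSet_exists_gap hℓ hK hm isOpen_Iio).union
    ((measurableSet_gap_nonempty hℓ hK hm).compl.inter (MeasurableSet.const _))

variable {m : ℕ}

lemma measurableSet_gap_region (hℓ : 0 < ℓ) :
    MeasurableSet {ω : Fin m → ℝ × ℝ | (gap ℓ (region ω)).Nonempty} :=
  measurableSet_gap_nonempty hℓ isClosed_region measurableSet_mem_region

lemma measurableSet_covered_region (hℓ : 0 < ℓ) :
    MeasurableSet {ω : Fin m → ℝ × ℝ | Icc 0 ℓ ⊆ region ω} := by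
  simp_rw [subset_iff_not_gap_nonempty]
  exact (measurableSet_gap_region hℓ).compl

lemma measurable_gapSup_region (hℓ : 0 < ℓ) :
    Measurable fun ω : Fin m → ℝ × ℝ => gapSup ℓ (region ω) :=
  measurable_gapSup hℓ isClosed_region measurableSet_mem_region

lemma measurable_gapInf_region (hℓ : 0 < ℓ) :
    Measurable fun ω : Fin m → ℝ × ℝ => gapInf ℓ (region ω) :=
  measurable_gapInf hℓ isClosed_region measurableSet_mem_region

lemma measurable_reach_region (hℓ : 0 < ℓ) :
    Measurable fun p : (Fin m → ℝ × ℝ) × ℝ => reach ℓ (region p.1) p.2 :=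
  (measurable_snd.sub ((measurable_gapInf_region hℓ).comp measurable_fst)).max
    (((measurable_gapSup_region hℓ).comp measurable_fst).sub measurable_snd)

lemma measurable_gap_indicator (hℓ : 0 < ℓ) {f : (Fin m → ℝ × ℝ) × ℝ → ENNReal}
    (hf : Measurable f) :
    Measurable ({p : (Fin m → ℝ × ℝ) × ℝ | (gap ℓ (region p.1)).Nonempty}.indicator f) :=
  hf.indicator (measurable_fst (measurableSet_gap_region hℓ))

end Measurability

/-! ### The law of a family of balls and its derivative in the scale -/

lemma pi_withDensity {ι : Type*} [Fintype ι] {X : ι → Type*} [∀ i, MeasurableSpace (X i)]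
    (μ : ∀ i, Measure (X i)) [∀ i, IsProbabilityMeasure (μ i)] {f : ∀ i, X i → ENNReal}
    (hf : ∀ i, Measurable (f i)) [∀ i, SigmaFinite ((μ i).withDensity (f i))] :
    Measure.pi (fun i => (μ i).withDensity (f i))
      = (Measure.pi μ).withDensity fun x => ∏ i, f i (x i) := by
  refine Measure.pi_eq fun s hs => ?_
  rw [withDensity_apply _ (MeasurableSet.univ_pi hs),
    ← lintegral_indicator (MeasurableSet.univ_pi hs)]
  have e : ∀ x : ∀ i, X i, (univ.pi s).indicator (fun x => ∏ i, f i (x i)) x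
      = ∏ i, (s i).indicator (f i) (x i) := by
    intro x
    by_cases hx : x ∈ univ.pi s
    · rw [indicator_of_mem hx]
      exact Finset.prod_congr rfl fun i _ => (indicator_of_mem (hx i (mem_univ i)) _).symm
    · rw [indicator_of_notMem hx]
      obtain ⟨i, hi⟩ : ∃ i, x i ∉ s i := by simpa [mem_pi] using hx
      exact (Finset.prod_eq_zero (Finset.mem_univ i) (indicator_of_notMem hi _)).symm
  simp_rw [e]
  rw [lintegral_prod_eq_prod_lintegral_of_indepFun Finset.univ
    (fun i (x : ∀ i, X i) => (s i).indicator (f i) (x i))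
    (iIndepFun_pi fun i => ((hf i).indicator (hs i)).aemeasurable)
    fun i => ((hf i).indicator (hs i)).comp (measurable_pi_apply i)]
  refine Finset.prod_congr rfl fun i _ => ?_
  rw [withDensity_apply _ (hs i), ← lintegral_indicator (hs i)]
  exact (measurePreserving_eval μ i).lintegral_comp ((hf i).indicator (hs i))

/-- The law of `m` independent balls: the centre of the `i`-th one has law `ν i`, its radius is
exponential with rate `w i / r`. -/
noncomputable def cfgLaw {m : ℕ} (ν : Fin m → Measure ℝ) (w : Fin m → ℝ) (r : ℝ) :
    Measure (Fin m → ℝ × ℝ) :=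
  Measure.pi fun i => (ν i).prod (expMeasure (w i / r))

section CfgLaw

variable {m : ℕ} {ν : Fin m → Measure ℝ} [∀ i, IsProbabilityMeasure (ν i)] {w : Fin m → ℝ}

lemma isProbabilityMeasure_cfgLaw (hw : ∀ i, 0 < w i) {r : ℝ} (hr : 0 < r) :
    IsProbabilityMeasure (cfgLaw ν w r) := by
  have := fun i => isProbabilityMeasure_expMeasure (div_pos (hw i) hr)
  unfold cfgLaw
  infer_instance

lemma expMeasure_withDensity {w r₀ r : ℝ} (hw : 0 < w) (hr₀ : 0 < r₀) (hr : 0 < r) :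
    expMeasure (w / r) = (expMeasure (w / r₀)).withDensity
      fun s => ENNReal.ofReal (r₀ / r * Real.exp ((1 / r₀ - 1 / r) * (w * s))) := by
  rw [expMeasure_eq_withDensity, expMeasure_eq_withDensity, ← withDensity_mul _ (by fun_prop)
    (by fun_prop)]
  congr 1
  ext s
  rw [Pi.mul_apply, ← ENNReal.ofReal_mul (by positivity)]
  congr 1
  rw [mul_mul_mul_comm, ← Real.exp_add]
  congr 1
  · field_simp
  · congr 1; field_simp; ring

/-- Changing the scale `r` tilts the law of the configuration by the exponential of a multiple of
the weighted total radius. -/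
lemma cfgLaw_eq_withDensity (hw : ∀ i, 0 < w i) {r₀ r : ℝ} (hr₀ : 0 < r₀) (hr : 0 < r) :
    cfgLaw ν w r = (cfgLaw ν w r₀).withDensity fun ω =>
      ENNReal.ofReal ((r₀ / r) ^ m * Real.exp ((1 / r₀ - 1 / r) * ∑ i, w i * (ω i).2)) := by
  have h0 := fun i => isProbabilityMeasure_expMeasure (div_pos (hw i) hr₀)
  have h1 := fun i => isProbabilityMeasure_expMeasure (div_pos (hw i) hr)
  have e : ∀ i, (ν i).prod (expMeasure (w i / r))
      = ((ν i).prod (expMeasure (w i / r₀))).withDensity fun z =>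
        ENNReal.ofReal (r₀ / r * Real.exp ((1 / r₀ - 1 / r) * (w i * z.2))) := by
    intro i
    have h1' := h1 i
    rw [expMeasure_withDensity (hw i) hr₀ hr] at h1' ⊢
    rw [prod_withDensity_right (by fun_prop)]
  have hs : ∀ i, SigmaFinite (((ν i).prod (expMeasure (w i / r₀))).withDensity fun z =>
        ENNReal.ofReal (r₀ / r * Real.exp ((1 / r₀ - 1 / r) * (w i * z.2)))) := by
    intro i
    rw [← e i]
    infer_instance
  unfold cfgLaw
  simp_rw [e]
  rw [pi_withDensity _ fun i => by fun_prop]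
  congr 1
  ext ω
  rw [← ENNReal.ofReal_prod_of_nonneg fun i _ => by positivity, Finset.prod_mul_distrib,
    Finset.mul_sum, Real.exp_sum]
  simp [div_pow]

lemma integrable_exp_totalRadius (hw : ∀ i, 0 < w i) {r t : ℝ} (hr : 0 < r) (ht : t < 1 / r) :
    Integrable (fun ω => Real.exp (t * ∑ i, w i * (ω i).2)) (cfgLaw ν w r) := by
  have hr' : 0 < 1 / (1 / r - t) := by apply one_div_pos.2; linarith
  have := isProbabilityMeasure_cfgLaw (ν := ν) hw hr'
  have h := measure_univ (μ := cfgLaw ν w (1 / (1 / r - t)))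
  rw [cfgLaw_eq_withDensity hw hr hr', withDensity_apply _ MeasurableSet.univ,
    Measure.restrict_univ] at h
  have e : 1 / r - 1 / (1 / (1 / r - t)) = t := by simp
  rw [e] at h
  have hi : Integrable (fun ω => (r / (1 / (1 / r - t))) ^ m *
      Real.exp (t * ∑ i, w i * (ω i).2)) (cfgLaw ν w r) := by
    refine ⟨Measurable.aestronglyMeasurable (by fun_prop), ?_⟩
    rw [hasFiniteIntegral_iff_ofReal (Filter.Eventually.of_forall fun ω => by positivity), h]
    exact ENNReal.one_lt_top
  have hc : (r / (1 / (1 / r - t))) ^ m ≠ 0 := by positivity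
  refine (hi.const_mul ((r / (1 / (1 / r - t))) ^ m)⁻¹).congr
    (Filter.Eventually.of_forall fun ω => ?_)
  simp only
  rw [← mul_assoc, inv_mul_cancel₀ hc, one_mul]

lemma integrable_totalRadius_term (hw : ∀ i, 0 < w i) {r : ℝ} (hr : 0 < r) (j : Fin m) :
    Integrable (fun ω : Fin m → ℝ × ℝ => (ω j).2) (cfgLaw ν w r) := by
  have h0 := fun i => isProbabilityMeasure_expMeasure (div_pos (hw i) hr)
  have h1 : Integrable (fun z : ℝ × ℝ => z.2) ((ν j).prod (expMeasure (w j / r))) :=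
    (integrable_id_expMeasure (div_pos (hw j) hr)).comp_snd _
  exact (measurePreserving_eval (fun i => (ν i).prod (expMeasure (w i / r))) j)
    |>.integrable_comp_of_integrable h1

/-- The derivative in the scale of the probability of any event, as the mean of the score. -/
lemma hasDerivAt_cfgLaw (hw : ∀ i, 0 < w i) {r : ℝ} (hr : 0 < r)
    {A : Set (Fin m → ℝ × ℝ)} (hA : MeasurableSet A) :
    HasDerivAt (fun r => (cfgLaw ν w r).real A)
      (1 / r * ∑ j, ∫ ω in A, (w j / r * (ω j).2 - 1) ∂cfgLaw ν w r) r := by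
  have hP := isProbabilityMeasure_cfgLaw (ν := ν) hw hr
  set S : (Fin m → ℝ × ℝ) → ℝ := fun ω => ∑ i, w i * (ω i).2 with hS
  set P := cfgLaw ν w r with hPdef
  have hmgf : ∀ᶠ x in nhds r, (cfgLaw ν w x).real A
      = (r / x) ^ m * mgf S (P.restrict A) (1 / r - 1 / x) := by
    filter_upwards [lt_mem_nhds hr] with x hx
    rw [cfgLaw_eq_withDensity hw hr hx, measureReal_def, withDensity_apply _ hA, mgf,
      ← integral_const_mul, integral_eq_lintegral_of_nonneg_ae
        (Filter.Eventually.of_forall fun ω => by positivity) (by fun_prop)]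
  have hint : (0 : ℝ) ∈ interior (integrableExpSet S (P.restrict A)) := by
    refine mem_interior.2 ⟨Iio (1 / r), fun t ht => ?_, isOpen_Iio, by simpa using hr⟩
    exact (integrable_exp_totalRadius hw hr ht).restrict
  have hd : HasDerivAt (mgf S (P.restrict A)) (∫ ω in A, S ω ∂P) 0 := by
    simpa using hasDerivAt_mgf hint
  have hrne := hr.ne'
  have h1 : HasDerivAt (fun x : ℝ => 1 / r - 1 / x) (1 / r ^ 2) r := by
    have := (hasDerivAt_inv hrne).const_sub (1 / r)
    simpa [one_div] using this
  have h2 : HasDerivAt (fun x : ℝ => (r / x) ^ m) (-(m / r)) r := by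
    have h3 : HasDerivAt (fun x : ℝ => r / x) (-(1 / r)) r := by
      have := (hasDerivAt_inv hrne).const_mul r
      simp only [← div_eq_mul_inv] at this
      refine this.congr_deriv ?_
      field_simp
    refine (h3.fun_pow m).congr_deriv ?_
    rw [div_self hrne, one_pow]; ring
  have h4 : HasDerivAt (fun x : ℝ => mgf S (P.restrict A) (1 / r - 1 / x))
      ((∫ ω in A, S ω ∂P) * (1 / r ^ 2)) r := by
    refine HasDerivAt.comp r (h₂ := mgf S (P.restrict A)) ?_ h1
    simpa using hd
  refine ((h2.mul h4).congr_of_eventuallyEq hmgf).congr_deriv ?_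
  have hsum : ∑ j, ∫ ω in A, (w j / r * (ω j).2 - 1) ∂P
      = (∫ ω in A, S ω ∂P) / r - m * P.real A := by
    have hi : ∀ j, Integrable (fun ω : Fin m → ℝ × ℝ => (ω j).2) (P.restrict A) :=
      fun j => (integrable_totalRadius_term hw hr j).restrict
    have hj : ∀ j : Fin m, ∫ ω in A, (w j / r * (ω j).2 - 1) ∂P
        = (∫ ω in A, w j * (ω j).2 ∂P) / r - P.real A := by
      intro j
      rw [integral_sub ((hi j).const_mul _) (integrable_const _), integral_const_mul,
        integral_const_mul]
      simp
      ring
    simp_rw [hj]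
    rw [Finset.sum_sub_distrib, ← Finset.sum_div,
      ← integral_finsetSum _ fun j _ => (hi j).const_mul _]
    simp [hS]
  rw [hsum]
  simp [mgf]
  field_simp
  ring

end CfgLaw

section Split

variable {m : ℕ} {ν : Fin (m + 1) → Measure ℝ} [∀ i, IsProbabilityMeasure (ν i)]
  {w : Fin (m + 1) → ℝ}

/-- The law of the configuration without its `j`-th ball. -/
noncomputable def restLaw (ν : Fin (m + 1) → Measure ℝ) (w : Fin (m + 1) → ℝ) (r : ℝ)
    (j : Fin (m + 1)) : Measure (Fin m → ℝ × ℝ) :=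
  cfgLaw (fun i => ν (j.succAbove i)) (fun i => w (j.succAbove i)) r

lemma isProbabilityMeasure_restLaw (hw : ∀ i, 0 < w i) {r : ℝ} (hr : 0 < r) (j : Fin (m + 1)) :
    IsProbabilityMeasure (restLaw ν w r j) :=
  isProbabilityMeasure_cfgLaw (fun _ => hw _) hr

lemma measurePreserving_split (hw : ∀ i, 0 < w i) {r : ℝ} (hr : 0 < r) (j : Fin (m + 1)) :
    MeasurePreserving (fun ω : Fin (m + 1) → ℝ × ℝ =>
      (((fun i => ω (j.succAbove i)), (ω j).1), (ω j).2)) (cfgLaw ν w r)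
      (((restLaw ν w r j).prod (ν j)).prod (expMeasure (w j / r))) := by
  have h0 := fun i => isProbabilityMeasure_expMeasure (div_pos (hw i) hr)
  have hR := isProbabilityMeasure_restLaw (ν := ν) hw hr j
  have h1 := measurePreserving_piFinSuccAbove (fun i => (ν i).prod (expMeasure (w i / r))) j
  have h2 : MeasurePreserving Prod.swap
      (((ν j).prod (expMeasure (w j / r))).prod (restLaw ν w r j)) _ :=
    Measure.measurePreserving_swap
  have h3 := (measurePreserving_prodAssoc (restLaw ν w r j) (ν j) (expMeasure (w j / r))).symm
  exact h3.comp (h2.comp h1)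

/-- The influence of the `j`-th ball: the mean of `u * exp (-u)`, where `u` is the least range with
which that ball completes the covering, on the event that the other balls do not cover. -/
noncomputable def influence (ℓ : ℝ) (ν : Fin (m + 1) → Measure ℝ) (w : Fin (m + 1) → ℝ) (r : ℝ)
    (j : Fin (m + 1)) : ENNReal :=
  ∫⁻ p, {p : (Fin m → ℝ × ℝ) × ℝ | (gap ℓ (region p.1)).Nonempty}.indicator
    (fun p => ENNReal.ofReal (w j / r * reach ℓ (region p.1) p.2 *
      Real.exp (-(w j / r * reach ℓ (region p.1) p.2)))) p ∂((restLaw ν w r j).prod (ν j))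

lemma influence_le_one {ℓ : ℝ} (hw : ∀ i, 0 < w i) {r : ℝ} (hr : 0 < r) (j : Fin (m + 1)) :
    influence ℓ ν w r j ≤ 1 := by
  have hR := isProbabilityMeasure_restLaw (ν := ν) hw hr j
  refine (lintegral_mono (g := 1) fun p => ?_).trans (by simp)
  refine indicator_le (fun p _ => ?_) p
  rw [Pi.one_apply, ← ENNReal.ofReal_one]
  refine ENNReal.ofReal_le_ofReal ?_
  have h := Real.add_one_le_exp (w j / r * reach ℓ (region p.1) p.2)
  rw [Real.exp_neg, ← div_eq_mul_inv, div_le_one (Real.exp_pos _)]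
  linarith

/-- The configurations of a remaining family of balls, a centre and a radius for which adding the
corresponding ball gives a covering. -/
def completing (m : ℕ) (ℓ : ℝ) : Set (((Fin m → ℝ × ℝ) × ℝ) × ℝ) :=
  {q | (gap ℓ (region q.1.1)).Nonempty → reach ℓ (region q.1.1) q.1.2 ≤ q.2}

lemma measurableSet_completing {ℓ : ℝ} (hℓ : 0 < ℓ) : MeasurableSet (completing m ℓ) := by
  have e : completing m ℓ
      = (Prod.fst ⁻¹' (Prod.fst ⁻¹' {ω : Fin m → ℝ × ℝ | (gap ℓ (region ω)).Nonempty}))ᶜ ∪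
        {q | reach ℓ (region q.1.1) q.1.2 ≤ q.2} := by
    ext q
    simp only [completing, mem_ofPred_eq, mem_union, mem_compl_iff, mem_preimage, imp_iff_not_or]
  rw [e]
  exact (measurable_fst (measurable_fst (measurableSet_gap_region hℓ))).compl.union
    (measurableSet_le ((measurable_reach_region hℓ).comp measurable_fst) measurable_snd)

lemma covered_iff_completing {ℓ : ℝ} (j : Fin (m + 1)) (ω : Fin (m + 1) → ℝ × ℝ) :
    Icc 0 ℓ ⊆ region ω ↔
      (((fun i => ω (j.succAbove i)), (ω j).1), (ω j).2) ∈ completing m ℓ := by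
  rw [region_eq_union ω j]
  by_cases h : (gap ℓ (region fun i => ω (j.succAbove i))).Nonempty
  · rw [← Prod.mk.eta (p := ω j), subset_union_interval_iff h]
    simp [completing, h]
  · simp only [completing, mem_ofPred_eq, h, false_imp_iff, iff_true]
    exact (subset_iff_not_gap_nonempty.2 h).trans subset_union_left

/-- Conditioning on all balls but the `j`-th one: the probability of being covered is the
probability that the other balls cover, plus the probability that the `j`-th one is needed and large
enough. -/
lemma cfgLaw_covered_eq {ℓ : ℝ} (hℓ : 0 < ℓ) (hw : ∀ i, 0 < w i) {r : ℝ} (hr : 0 < r)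
    (j : Fin (m + 1)) :
    cfgLaw ν w r {ω | Icc 0 ℓ ⊆ region ω} = restLaw ν w r j {ω | Icc 0 ℓ ⊆ region ω} +
      ∫⁻ p, {p : (Fin m → ℝ × ℝ) × ℝ | (gap ℓ (region p.1)).Nonempty}.indicator
        (fun p => ENNReal.ofReal (Real.exp (-(w j / r * reach ℓ (region p.1) p.2)))) p
          ∂((restLaw ν w r j).prod (ν j)) := by
  have hc := div_pos (hw j) hr
  have h0 := isProbabilityMeasure_expMeasure hc
  have hR := isProbabilityMeasure_restLaw (ν := ν) hw hr j
  have hsplit := measurePreserving_split (ν := ν) hw hr j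
  have hcov := measurableSet_covered_region (m := m) hℓ
  have e : {ω : Fin (m + 1) → ℝ × ℝ | Icc 0 ℓ ⊆ region ω}
      = (fun ω => (((fun i => ω (j.succAbove i)), (ω j).1), (ω j).2)) ⁻¹' completing m ℓ :=
    Set.ext fun ω => covered_iff_completing j ω
  rw [e, hsplit.measure_preimage (measurableSet_completing hℓ).nullMeasurableSet,
    Measure.prod_apply (measurableSet_completing hℓ)]
  have e2 : ∀ p : (Fin m → ℝ × ℝ) × ℝ,
      expMeasure (w j / r) (Prod.mk p ⁻¹' completing m ℓ)
      = (Prod.fst ⁻¹' {ω : Fin m → ℝ × ℝ | Icc 0 ℓ ⊆ region ω}).indicator 1 p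
        + {p : (Fin m → ℝ × ℝ) × ℝ | (gap ℓ (region p.1)).Nonempty}.indicator
        (fun p => ENNReal.ofReal (Real.exp (-(w j / r * reach ℓ (region p.1) p.2)))) p := by
    intro p
    by_cases h : (gap ℓ (region p.1)).Nonempty
    · rw [indicator_of_notMem (fun h' => (subset_iff_not_gap_nonempty.1 h') h),
        indicator_of_mem (by exact h), zero_add, ← expMeasure_Ici hc (reach_nonneg p.2)]
      congr 1
      ext s
      simp [completing, h]
    · rw [indicator_of_mem (subset_iff_not_gap_nonempty.2 h), indicator_of_notMem (by exact h)]
      have : Prod.mk p ⁻¹' completing m ℓ = univ := by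
        ext s
        simp [completing, h]
      rw [this, measure_univ]
      simp
  simp_rw [e2]
  rw [lintegral_add_left (measurable_one.indicator (measurable_fst hcov)),
    lintegral_indicator_one (measurable_fst hcov), ← prod_univ, Measure.prod_prod, measure_univ,
    mul_one]

/-- The mean of the score of the `j`-th ball on the event of being covered, by conditioning on the
other balls: if they cover, the score integrates to `0`; otherwise `setIntegral_expMeasure_Ici`
applies. -/
lemma setIntegral_score {ℓ : ℝ} (hℓ : 0 < ℓ) (hw : ∀ i, 0 < w i) {r : ℝ} (hr : 0 < r)
    (j : Fin (m + 1)) :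
    ∫ ω in {ω | Icc 0 ℓ ⊆ region ω}, (w j / r * (ω j).2 - 1) ∂cfgLaw ν w r
      = (influence ℓ ν w r j).toReal := by
  have h0 := isProbabilityMeasure_expMeasure (div_pos (hw j) hr)
  have hR := isProbabilityMeasure_restLaw (ν := ν) hw hr j
  have hc := div_pos (hw j) hr
  have hsplit := measurePreserving_split (ν := ν) hw hr j
  set c := w j / r with hcdef
  set B := completing m ℓ with hB
  have hBm : MeasurableSet B := measurableSet_completing hℓ
  have hiff := covered_iff_completing (m := m) (ℓ := ℓ) j
  have hF : Integrable (fun q : ((Fin m → ℝ × ℝ) × ℝ) × ℝ => B.indicator (fun q => c * q.2 - 1) q)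
      (((restLaw ν w r j).prod (ν j)).prod (expMeasure c)) := by
    refine Integrable.indicator ?_ hBm
    exact (((integrable_id_expMeasure hc).comp_snd _).const_mul c).sub (integrable_const 1)
  rw [← integral_indicator (measurableSet_covered_region hℓ)]
  have e1 : ∀ ω : Fin (m + 1) → ℝ × ℝ,
      {ω | Icc 0 ℓ ⊆ region ω}.indicator (fun ω => c * (ω j).2 - 1) ω
      = B.indicator (fun q => c * q.2 - 1) (((fun i => ω (j.succAbove i)), (ω j).1), (ω j).2) := by
    intro ω
    by_cases h : Icc 0 ℓ ⊆ region ω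
    · rw [indicator_of_mem (by exact h), indicator_of_mem ((hiff ω).1 h)]
    · rw [indicator_of_notMem (by exact h), indicator_of_notMem fun h' => h ((hiff ω).2 h')]
  simp_rw [e1]
  rw [← integral_map (φ := fun ω : Fin (m + 1) → ℝ × ℝ =>
      (((fun i => ω (j.succAbove i)), (ω j).1), (ω j).2)) (f := B.indicator fun q => c * q.2 - 1)
      hsplit.measurable.aemeasurable (by rw [hsplit.map_eq]; exact hF.1),
    hsplit.map_eq, integral_prod _ hF, influence]
  have e2 : ∀ p : (Fin m → ℝ × ℝ) × ℝ,
      ∫ s, B.indicator (fun q => c * q.2 - 1) (p, s) ∂expMeasure c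
      = {p : (Fin m → ℝ × ℝ) × ℝ | (gap ℓ (region p.1)).Nonempty}.indicator
        (fun p => c * reach ℓ (region p.1) p.2 * Real.exp (-(c * reach ℓ (region p.1) p.2))) p := by
    intro p
    by_cases h : (gap ℓ (region p.1)).Nonempty
    · rw [indicator_of_mem (by exact h), ← setIntegral_expMeasure_Ici hc (reach_nonneg p.2),
        ← integral_indicator measurableSet_Ici]
      refine integral_congr_ae (Filter.Eventually.of_forall fun s => ?_)
      by_cases hs : reach ℓ (region p.1) p.2 ≤ s
      · simp only
        rw [indicator_of_mem (show (p, s) ∈ B from fun _ => hs),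
          indicator_of_mem (show s ∈ Ici _ from hs)]
      · simp only
        rw [indicator_of_notMem (show (p, s) ∉ B from fun h' => hs (h' h)),
          indicator_of_notMem (show s ∉ Ici _ from hs)]
    · rw [indicator_of_notMem (by exact h)]
      have h2 := setIntegral_expMeasure_Ici hc le_rfl
      rw [setIntegral_congr_set (t := univ) (by
        filter_upwards [ae_pos_expMeasure c] with s hs
        exact propext ⟨fun _ => trivial, fun _ => hs.le⟩)] at h2
      have hmem : ∀ s, (p, s) ∈ B := fun s h' => absurd h' h
      simpa [indicator_of_mem (hmem _)] using h2
  simp_rw [e2]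
  rw [integral_eq_lintegral_of_nonneg_ae]
  · congr 2
    ext p
    by_cases h : (gap ℓ (region p.1)).Nonempty <;> simp [h, hcdef]
  · refine Filter.Eventually.of_forall fun p => indicator_nonneg (fun p _ => ?_) p
    have := reach_nonneg (ℓ := ℓ) (K := region p.1) p.2
    positivity
  · have := measurable_reach_region (m := m) hℓ
    exact (Measurable.indicator (by fun_prop)
      (measurable_fst (measurableSet_gap_region hℓ))).aestronglyMeasurable

/-- The derivative in the scale of the probability of being covered is the sum of the influences. -/
lemma hasDerivAt_covered {ℓ : ℝ} (hℓ : 0 < ℓ) (hw : ∀ i, 0 < w i) {r : ℝ} (hr : 0 < r) :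
    HasDerivAt (fun r => (cfgLaw ν w r).real {ω | Icc 0 ℓ ⊆ region ω})
      (1 / r * ∑ j, (influence ℓ ν w r j).toReal) r := by
  simp_rw [← setIntegral_score hℓ hw hr]
  exact hasDerivAt_cfgLaw hw hr (measurableSet_covered_region hℓ)

end Split

/-! ### Reduction of the model to a fixed number of internal points -/

/-- The laws of the centres: the two ends of the segment come first, all others are uniform. -/
noncomputable def centreLaw (ℓ : ℝ) (i : ℕ) : Measure ℝ :=
  if i = 0 then Measure.dirac 0 else if i = 1 then Measure.dirac ℓ
    else (volume : Measure ℝ)[|Icc 0 ℓ]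

/-- The rates of the radii when `r = 1`: `1` at the two ends, `2` at an internal point. -/
noncomputable def rate (i : ℕ) : ℝ := if i < 2 then 1 else 2

lemma rate_pos (i : ℕ) : 0 < rate i := by unfold rate; split_ifs <;> norm_num

/-- The law of the balls when there are `n` internal points. -/
noncomputable def modelLaw (ℓ : ℝ) (n : ℕ) (r : ℝ) : Measure (Fin (n + 2) → ℝ × ℝ) :=
  cfgLaw (fun i => centreLaw ℓ i) (fun i => rate i) r

/-- The probability that the segment is covered when there are `n` internal points. -/
noncomputable def coverProbGiven (ℓ : ℝ) (n : ℕ) (r : ℝ) : ℝ :=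
  (modelLaw ℓ n r).real {ω | Icc 0 ℓ ⊆ region ω}

lemma isProbabilityMeasure_uniform {ℓ : ℝ} (hℓ : 0 < ℓ) :
    IsProbabilityMeasure ((volume : Measure ℝ)[|Icc 0 ℓ]) :=
  cond_isProbabilityMeasure_of_finite (by simpa using hℓ) (by simp)

lemma isProbabilityMeasure_centreLaw {ℓ : ℝ} (hℓ : 0 < ℓ) (i : ℕ) :
    IsProbabilityMeasure (centreLaw ℓ i) := by
  have := isProbabilityMeasure_uniform hℓ
  unfold centreLaw
  split_ifs <;> infer_instance

lemma isProbabilityMeasure_modelLaw {ℓ : ℝ} (hℓ : 0 < ℓ) (n : ℕ) {r : ℝ} (hr : 0 < r) :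
    IsProbabilityMeasure (modelLaw ℓ n r) := by
  have := fun i : Fin (n + 2) => isProbabilityMeasure_centreLaw hℓ i
  exact isProbabilityMeasure_cfgLaw (fun i => rate_pos i) hr

lemma expMeasure_Ici_max {c : ℝ} (hc : 0 < c) (t : ℝ) :
    expMeasure c (Ici t) = ENNReal.ofReal (Real.exp (-(c * max t 0))) := by
  rcases le_total 0 t with ht | ht
  · rw [max_eq_left ht, expMeasure_Ici hc ht]
  · rw [max_eq_right ht, ← expMeasure_Ici hc le_rfl]
    refine measure_congr ?_
    filter_upwards [ae_pos_expMeasure c] with s hs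
    exact propext ⟨fun _ => hs.le, fun _ => ht.trans hs.le⟩

lemma expMeasure_map_mul {k : ℝ} (hk : 0 < k) :
    (expMeasure 1).map (fun s => k * s) = expMeasure (1 / k) := by
  have := isProbabilityMeasure_expMeasure one_pos
  have := isProbabilityMeasure_expMeasure (one_div_pos.2 hk)
  have hm : Measurable fun s : ℝ => k * s := by fun_prop
  have := Measure.isProbabilityMeasure_map (μ := expMeasure 1) hm.aemeasurable
  refine Measure.ext_of_Ici _ _ fun t => ?_
  rw [Measure.map_apply hm measurableSet_Ici]
  have : (fun s : ℝ => k * s) ⁻¹' Ici t = Ici (t / k) := by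
    ext s; simp [div_le_iff₀' hk]
  rw [this, expMeasure_Ici_max one_pos, expMeasure_Ici_max (one_div_pos.2 hk)]
  congr 3
  rw [one_mul, ← zero_div k, max_div_div_right hk.le]
  simp; ring

lemma infinitePi_map_comp {m : ℕ} (P : Measure ℝ) [IsProbabilityMeasure P] {g : Fin m → ℕ}
    (hg : g.Injective) {f : Fin m → ℝ → ℝ} (hf : ∀ i, Measurable (f i)) :
    (Measure.infinitePi fun _ : ℕ => P).map (fun ω i => f i (ω (g i)))
      = Measure.pi fun i => P.map (f i) := by
  have h : (fun (ω : ℕ → ℝ) i => f i (ω (g i)))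
      = (fun (x : Fin m → ℝ) i => f i (x i)) ∘ fun ω i => ω (g i) := rfl
  have hm := fun i => Measure.isProbabilityMeasure_map (μ := P) (hf i).aemeasurable
  rw [h, ← Measure.map_map (by fun_prop) (by fun_prop),
    Measure.map_infinitePi_infinitePi_of_inj hg, Measure.infinitePi_map_pi _ hf,
    Measure.infinitePi_eq_pi]

/-- The index, among the locations and ranges of a sample with `n` internal points, of the `i`-th
ball when the two ends of the segment are listed first. -/
def sampleIndex (n : ℕ) (i : Fin (n + 2)) : ℕ :=
  if (i : ℕ) = 0 then 0 else if (i : ℕ) = 1 then n + 1 else i - 1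

lemma sampleIndex_injective (n : ℕ) : (sampleIndex n).Injective := by
  intro i j h
  unfold sampleIndex at h
  ext
  split_ifs at h <;> omega

/-- The balls of a sample with `n` internal points, the two ends of the segment listed first. -/
noncomputable def sampleBalls (ℓ r : ℝ) (n : ℕ) (p : (ℕ → ℝ) × (ℕ → ℝ)) (i : Fin (n + 2)) : ℝ × ℝ :=
  (if (i : ℕ) = 0 then 0 else if (i : ℕ) = 1 then ℓ else p.1 (sampleIndex n i),
    r / rate i * p.2 (sampleIndex n i))

lemma interval_sampleBalls (ℓ r : ℝ) (n : ℕ) (p : (ℕ → ℝ) × (ℕ → ℝ)) (i : Fin (n + 2)) :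
    interval (sampleBalls ℓ r n p i) =
      Icc (point ℓ (n, p) (sampleIndex n i) - radius r (n, p) (sampleIndex n i))
        (point ℓ (n, p) (sampleIndex n i) + radius r (n, p) (sampleIndex n i)) := by
  have h1 : point ℓ (n, p) (sampleIndex n i) = (sampleBalls ℓ r n p i).1 := by
    have := i.2
    simp only [point, sampleBalls, sampleIndex]
    split_ifs <;> first | rfl | omega | contradiction
  have h2 : radius r (n, p) (sampleIndex n i) = (sampleBalls ℓ r n p i).2 := by
    have := i.2
    simp only [radius, sampleBalls, sampleIndex, rate]
    split_ifs <;> first | omega | simp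
  rw [h1, h2]
  rfl

lemma covered_eq_region (ℓ r : ℝ) (n : ℕ) (p : (ℕ → ℝ) × (ℕ → ℝ)) :
    covered ℓ r (n, p) = region (sampleBalls ℓ r n p) := by
  unfold covered region
  simp_rw [interval_sampleBalls]
  refine Subset.antisymm (iUnion₂_subset fun j hj => ?_) (iUnion_subset fun i => ?_)
  · have hj' : j < n + 2 := Finset.mem_range.1 hj
    obtain ⟨i, hi⟩ : ∃ i : Fin (n + 2), sampleIndex n i = j := by
      by_cases h0 : j = 0
      · exact ⟨⟨0, by omega⟩, by simp [sampleIndex, h0]⟩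
      · by_cases h1 : j = n + 1
        · exact ⟨⟨1, by omega⟩, by simp [sampleIndex, h1]⟩
        · exact ⟨⟨j + 1, by omega⟩, by simp [sampleIndex, h0]⟩
    exact subset_iUnion_of_subset i (by rw [hi])
  · refine subset_iUnion₂_of_subset (sampleIndex n i) (Finset.mem_range.2 ?_) subset_rfl
    have := i.2
    unfold sampleIndex
    change _ < n + 2
    split_ifs <;> omega

lemma measurePreserving_sampleBalls {ℓ r : ℝ} (hℓ : 0 < ℓ) (hr : 0 < r) (n : ℕ) :
    MeasurePreserving (sampleBalls ℓ r n)
      ((Measure.infinitePi fun _ : ℕ => (volume : Measure ℝ)[|Icc 0 ℓ]).prod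
        (Measure.infinitePi fun _ : ℕ => expMeasure 1)) (modelLaw ℓ n r) := by
  have h0 := isProbabilityMeasure_uniform hℓ
  have h1 := isProbabilityMeasure_expMeasure one_pos
  have h2 := fun i : Fin (n + 2) => isProbabilityMeasure_centreLaw hℓ i
  have h3 := fun i : Fin (n + 2) => isProbabilityMeasure_expMeasure (div_pos (rate_pos i) hr)
  set f : Fin (n + 2) → ℝ → ℝ :=
    fun i u => if (i : ℕ) = 0 then 0 else if (i : ℕ) = 1 then ℓ else u with hf
  have hfm : ∀ i, Measurable (f i) := by
    intro i
    simp only [hf]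
    split_ifs <;> fun_prop
  have hu : MeasurePreserving (fun (u : ℕ → ℝ) (i : Fin (n + 2)) => f i (u (sampleIndex n i)))
      (Measure.infinitePi fun _ : ℕ => (volume : Measure ℝ)[|Icc 0 ℓ])
      (Measure.pi fun i : Fin (n + 2) => centreLaw ℓ i) := by
    refine ⟨measurable_pi_lambda _ fun i => (hfm i).comp (measurable_pi_apply _), ?_⟩
    rw [infinitePi_map_comp _ (sampleIndex_injective n) hfm]
    congr 1
    ext1 i
    simp only [hf, centreLaw]
    split_ifs <;> simp [Measure.map_const, Measure.map_id']
  have he : MeasurePreserving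
      (fun (e : ℕ → ℝ) (i : Fin (n + 2)) => r / rate i * e (sampleIndex n i))
      (Measure.infinitePi fun _ : ℕ => expMeasure 1)
      (Measure.pi fun i : Fin (n + 2) => expMeasure (rate i / r)) := by
    refine ⟨by fun_prop, ?_⟩
    rw [infinitePi_map_comp (f := fun i e => r / rate i * e) _ (sampleIndex_injective n)
      (by fun_prop)]
    congr 1
    ext1 i
    rw [expMeasure_map_mul (div_pos hr (rate_pos i)), one_div_div]
  exact (measurePreserving_arrowProdEquivProdArrow ℝ ℝ (Fin (n + 2)) _ _).symm.comp (hu.prod he)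

lemma coverProb_eq_tsum {ℓ lam r : ℝ} (hℓ : 0 < ℓ) (hlam : 0 ≤ lam) (hr : 0 < r) :
    coverProb ℓ lam r = ∑' n : ℕ,
      Real.exp (-(lam * ℓ)) * (lam * ℓ) ^ n / n.factorial * coverProbGiven ℓ n r := by
  have h0 := isProbabilityMeasure_uniform hℓ
  have h1 := isProbabilityMeasure_expMeasure one_pos
  have hsec : ∀ n : ℕ, Prod.mk n ⁻¹' {ω : Sample | Icc 0 ℓ ⊆ covered ℓ r ω}
      = sampleBalls ℓ r n ⁻¹' {ω | Icc 0 ℓ ⊆ region ω} := by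
    intro n
    ext p
    simp only [mem_preimage, mem_ofPred_eq, covered_eq_region]
  have hm : MeasurableSet {ω : Sample | Icc 0 ℓ ⊆ covered ℓ r ω} := by
    have e : {ω : Sample | Icc 0 ℓ ⊆ covered ℓ r ω} = ⋃ n : ℕ, {n} ×ˢ
        (sampleBalls ℓ r n ⁻¹' {ω | Icc 0 ℓ ⊆ region ω}) := by
      ext ⟨n, p⟩
      simp [covered_eq_region]
    rw [e]
    exact MeasurableSet.iUnion fun n => (measurableSet_singleton n).prod
      ((measurePreserving_sampleBalls hℓ hr n).measurable (measurableSet_covered_region hℓ))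
  unfold coverProb law
  rw [measureReal_def, Measure.prod_apply hm, ← integral_toReal
    (Measurable.of_discrete).aemeasurable (Filter.Eventually.of_forall fun _ => measure_lt_top _ _),
    integral_poissonMeasure]
  refine tsum_congr fun n => ?_
  rw [hsec, (measurePreserving_sampleBalls hℓ hr n).measure_preimage
    (measurableSet_covered_region hℓ).nullMeasurableSet, Real.coe_toNNReal _ (by positivity)]
  rfl

/-! ### Integrals over the centre and the radius of one ball -/

section Integrals

lemma expMeasure_absolutelyContinuous (c : ℝ) : expMeasure c ≪ volume := by
  rw [expMeasure_eq_withDensity]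
  exact (withDensity_absolutelyContinuous _ _).trans Measure.absolutelyContinuous_restrict

lemma expMeasure_Icc {c u v : ℝ} (hc : 0 < c) (hu : 0 ≤ u) (huv : u ≤ v) :
    expMeasure c (Icc u v)
      = ENNReal.ofReal (Real.exp (-(c * u)) - Real.exp (-(c * v))) := by
  have := isProbabilityMeasure_expMeasure hc
  have h : expMeasure c (Icc u v) = expMeasure c (Ico u v) :=
    measure_congr ((expMeasure_absolutelyContinuous c).ae_eq Ico_ae_eq_Icc.symm)
  have h2 : Ico u v = Ici u \ Ici v := by ext s; simp
  rw [h, h2, measure_sdiff (Ici_subset_Ici.2 huv) measurableSet_Ici.nullMeasurableSet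
    (measure_ne_top _ _), expMeasure_Ici hc hu, expMeasure_Ici hc (hu.trans huv),
    ← ENNReal.ofReal_sub _ (Real.exp_pos _).le]

lemma lintegral_exp_neg_abs {k : ℝ} (hk : 0 < k) (c : ℝ) :
    ∫⁻ x, ENNReal.ofReal (Real.exp (-(k * |x - c|))) = ENNReal.ofReal (2 / k) := by
  have h1 : ∫⁻ x in Ioi (0 : ℝ), ENNReal.ofReal (Real.exp (-(k * x))) = ENNReal.ofReal (1 / k) := by
    have := isProbabilityMeasure_expMeasure hk
    have h := lintegral_expMeasure (c := k) (f := fun _ => ENNReal.ofReal (1 / k)) measurable_const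
    rw [lintegral_const, measure_univ, mul_one] at h
    rw [h]
    refine lintegral_congr fun x => ?_
    rw [← ENNReal.ofReal_mul (by positivity)]
    congr 1
    field_simp
  rw [lintegral_sub_right_eq_self (fun x => ENNReal.ofReal (Real.exp (-(k * |x|)))) c,
    ← lintegral_add_compl _ (measurableSet_Ioi (a := (0 : ℝ))), compl_Ioi]
  have h2 : ∫⁻ x in Ioi (0 : ℝ), ENNReal.ofReal (Real.exp (-(k * |x|)))
      = ENNReal.ofReal (1 / k) := by
    rw [← h1]
    refine setLIntegral_congr_fun measurableSet_Ioi fun x hx => ?_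
    rw [abs_of_pos hx]
  have h3 : ∫⁻ x in Iic (0 : ℝ), ENNReal.ofReal (Real.exp (-(k * |x|)))
      = ENNReal.ofReal (1 / k) := by
    rw [← restrict_Iio_eq_restrict_Iic, ← h2]
    have h := (Measure.measurePreserving_neg (volume : Measure ℝ)).setLIntegral_comp_preimage
      (measurableSet_Ioi (a := (0 : ℝ)))
      (f := fun x => ENNReal.ofReal (Real.exp (-(k * |x|)))) (by fun_prop)
    simpa using h
  rw [h2, h3, ← ENNReal.ofReal_add (by positivity) (by positivity)]
  congr 1
  ring

variable {r ℓ a b : ℝ}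

/-- Add a ball with uniform centre whose right end `x + s` is the new left end of the uncovered
hull. The substitution of `x + s` for `x` makes the inner integral explicit. -/
lemma lintegral_left_uniform_le (hr : 0 < r) (ha : 0 ≤ a) (hab : a ≤ b) :
    ∫⁻ x in Icc 0 ℓ, ∫⁻ s, {s | x - s ≤ a ∧ a ≤ x + s ∧ x + s ≤ b}.indicator
        (fun s => ENNReal.ofReal (Real.exp (-((b - (x + s)) / r)))) s ∂expMeasure (2 / r)
      ≤ ENNReal.ofReal ((b - a) * Real.exp (-((b - a) / r)) * (1 - Real.exp (-((a + b) / r)))) := by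
  have hc : 0 < 2 / r := by positivity
  have := isProbabilityMeasure_expMeasure hc
  set D : Set (ℝ × ℝ) := {p | p.1 - 2 * p.2 ≤ a ∧ p.2 ≤ p.1 ∧ a ≤ p.1 ∧ p.1 ≤ b} with hD
  have hDm : MeasurableSet D := by
    simp only [hD, Set.ofPred_and]
    exact (measurableSet_le (by fun_prop) measurable_const).inter
      ((measurableSet_le (by fun_prop) (by fun_prop)).inter
        ((measurableSet_le measurable_const (by fun_prop)).inter
          (measurableSet_le (by fun_prop) measurable_const)))
  set F : ℝ × ℝ → ENNReal :=
    D.indicator fun p => ENNReal.ofReal (Real.exp (-((b - p.1) / r))) with hF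
  have hFm : Measurable F := Measurable.indicator (by fun_prop) hDm
  have hexp : ∀ β ∈ Icc a b, ∫⁻ s, F (β, s) ∂expMeasure (2 / r)
      ≤ ENNReal.ofReal (Real.exp (-((b - a) / r)) * (1 - Real.exp (-((a + b) / r)))) := by
    intro β hβ
    have e : ∀ s, F (β, s) = (Icc ((β - a) / 2) β).indicator
        (fun _ => ENNReal.ofReal (Real.exp (-((b - β) / r)))) s := by
      intro s
      by_cases h : s ∈ Icc ((β - a) / 2) β
      · have : (β, s) ∈ D := ⟨by simp only; linarith [h.1], h.2, hβ.1, hβ.2⟩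
        rw [hF, indicator_of_mem this, indicator_of_mem h]
      · have : (β, s) ∉ D := fun h' => h ⟨by have := h'.1; simp only at this; linarith, h'.2.1⟩
        rw [hF, indicator_of_notMem this, indicator_of_notMem h]
    simp_rw [e]
    rw [lintegral_indicator measurableSet_Icc, setLIntegral_const,
      expMeasure_Icc hc (by linarith [hβ.1]) (by linarith [hβ.1]),
      ← ENNReal.ofReal_mul (Real.exp_pos _).le]
    refine ENNReal.ofReal_le_ofReal ?_
    rw [mul_sub, mul_sub, ← Real.exp_add, ← Real.exp_add, mul_one, ← Real.exp_add]
    have e1 : -((b - β) / r) + -(2 / r * ((β - a) / 2)) = -((b - a) / r) := by field_simp; ring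
    rw [e1]
    have e2 : -((b - a) / r) + -((a + b) / r) ≤ -((b - β) / r) + -(2 / r * β) := by
      have : -((b - β) / r) + -(2 / r * β) - (-((b - a) / r) + -((a + b) / r))
        = (b - β) / r := by field_simp; ring
      have h2 : 0 ≤ (b - β) / r := div_nonneg (by linarith [hβ.2]) hr.le
      linarith
    have := Real.exp_le_exp.2 e2
    linarith
  calc ∫⁻ x in Icc 0 ℓ, ∫⁻ s, {s | x - s ≤ a ∧ a ≤ x + s ∧ x + s ≤ b}.indicator
        (fun s => ENNReal.ofReal (Real.exp (-((b - (x + s)) / r)))) s ∂expMeasure (2 / r)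
      = ∫⁻ x in Icc 0 ℓ, ∫⁻ s, F (x + s, s) ∂expMeasure (2 / r) := by
        refine setLIntegral_congr_fun measurableSet_Icc fun x hx => lintegral_congr fun s => ?_
        by_cases h : x - s ≤ a ∧ a ≤ x + s ∧ x + s ≤ b
        · have h' : (x + s, s) ∈ D := ⟨by simp only; linarith [h.1], by simpa using hx.1, h.2⟩
          rw [indicator_of_mem (by exact h), hF, indicator_of_mem h']
        · have h' : (x + s, s) ∉ D := fun h' =>
            h ⟨by have := h'.1; simp only at this; linarith, h'.2.2⟩
          rw [indicator_of_notMem (by exact h), hF, indicator_of_notMem h']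
    _ ≤ ∫⁻ x, ∫⁻ s, F (x + s, s) ∂expMeasure (2 / r) := setLIntegral_le_lintegral _ _
    _ = ∫⁻ s, (∫⁻ x, F (x + s, s)) ∂expMeasure (2 / r) := by
        rw [lintegral_lintegral_swap (f := fun x s => F (x + s, s))]
        exact (hFm.comp (by fun_prop)).aemeasurable
    _ = ∫⁻ s, (∫⁻ β, F (β, s)) ∂expMeasure (2 / r) := by
        refine lintegral_congr fun s => ?_
        exact lintegral_add_right_eq_self (fun β => F (β, s)) s
    _ = ∫⁻ β, ∫⁻ s, F (β, s) ∂expMeasure (2 / r) := by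
        rw [lintegral_lintegral_swap (f := fun s β => F (β, s))]
        exact (hFm.comp measurable_swap).aemeasurable
    _ ≤ ∫⁻ β, (Icc a b).indicator (fun _ => ENNReal.ofReal
          (Real.exp (-((b - a) / r)) * (1 - Real.exp (-((a + b) / r))))) β := by
        refine lintegral_mono fun β => ?_
        by_cases h : β ∈ Icc a b
        · rw [indicator_of_mem h]
          exact hexp β h
        · have : ∀ s, F (β, s) = 0 := fun s => indicator_of_notMem (fun h' => h h'.2.2) _
          simp [this]
    _ = _ := by
        rw [lintegral_indicator measurableSet_Icc, setLIntegral_const, Real.volume_Icc, mul_comm,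
          ← ENNReal.ofReal_mul (by linarith), mul_assoc]

/-- Add a ball centred at the left end of the segment whose right end `0 + s` is the new left end of
the uncovered hull: the integrand is constant. -/
lemma lintegral_left_zero_le (hr : 0 < r) (hb : 0 ≤ b) :
    ∫⁻ s, {s | 0 - s ≤ a ∧ a ≤ 0 + s ∧ 0 + s ≤ b}.indicator
        (fun s => ENNReal.ofReal (Real.exp (-((b - (0 + s)) / r)))) s ∂expMeasure (1 / r)
      ≤ ENNReal.ofReal (b / r * Real.exp (-(b / r))) := by
  have hm : MeasurableSet {s : ℝ | 0 - s ≤ a ∧ a ≤ 0 + s ∧ 0 + s ≤ b} := by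
    simp only [Set.ofPred_and]
    exact (measurableSet_le (by fun_prop) measurable_const).inter
      ((measurableSet_le measurable_const (by fun_prop)).inter
        (measurableSet_le (by fun_prop) measurable_const))
  rw [lintegral_expMeasure (Measurable.indicator (by fun_prop) hm)]
  calc _ ≤ ∫⁻ s in Ioi (0 : ℝ), (Iic b).indicator
          (fun _ => ENNReal.ofReal (1 / r * Real.exp (-(b / r)))) s := by
        refine lintegral_mono fun s => ?_
        by_cases h : 0 - s ≤ a ∧ a ≤ 0 + s ∧ 0 + s ≤ b
        · rw [indicator_of_mem (by exact h),
            indicator_of_mem (show s ∈ Iic b by simpa using h.2.2),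
            ← ENNReal.ofReal_mul (by positivity), mul_assoc, ← Real.exp_add]
          refine (congrArg _ ?_).le
          congr 2
          field_simp
          ring
        · rw [indicator_of_notMem (by exact h), mul_zero]
          exact zero_le
    _ = _ := by
        rw [lintegral_indicator measurableSet_Iic, Measure.restrict_restrict measurableSet_Iic,
          Iic_inter_Ioi, setLIntegral_const, Real.volume_Ioc, mul_comm,
          ← ENNReal.ofReal_mul (by linarith)]
        congr 1
        ring

lemma lintegral_exp_neg_left (hr : 0 < r) {c : ℝ} (hc : 0 ≤ c) :
    ∫⁻ x in Ioc 0 c, ENNReal.ofReal (Real.exp (-(2 / r * (c - x))))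
      = ENNReal.ofReal (r / 2 * (1 - Real.exp (-(2 * c / r)))) := by
  rw [← ofReal_integral_eq_lintegral_ofReal
    ((Continuous.integrableOn_Icc (by fun_prop)).mono_set Ioc_subset_Icc_self)
    (Filter.Eventually.of_forall fun x => (Real.exp_pos _).le),
    ← intervalIntegral.integral_of_le hc]
  congr 1
  rw [intervalIntegral.integral_eq_sub_of_hasDerivAt
    (f := fun x => r / 2 * Real.exp (-(2 / r * (c - x))))]
  · rw [sub_self, mul_zero, neg_zero, Real.exp_zero, sub_zero, mul_sub, mul_one]
    congr 3
    ring
  · intro x _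
    have h1 : HasDerivAt (fun x : ℝ => -(2 / r * (c - x))) (2 / r) x := by
      refine (((hasDerivAt_id x).const_sub c).const_mul (2 / r)).fun_neg.congr_deriv ?_
      ring
    refine (h1.exp.const_mul (r / 2)).congr_deriv ?_
    field_simp
  · exact Continuous.intervalIntegrable (by fun_prop) _ _

/-- The influence of a ball with uniform centre, up to normalization, bounded below by the
contribution of the centres to the left of the middle of the hull. -/
lemma le_lintegral_uniform (hr : 0 < r) (ha : 0 ≤ a) (hab : a ≤ b) (hb : b ≤ ℓ) :
    ENNReal.ofReal ((b - a) * Real.exp (-((b - a) / r)) * (1 - Real.exp (-((a + b) / r))))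
      ≤ 2 * ∫⁻ x in Icc 0 ℓ, ENNReal.ofReal (2 / r * ((b - a) / 2 + |x - (a + b) / 2|) *
        Real.exp (-(2 / r * ((b - a) / 2 + |x - (a + b) / 2|)))) := by
  have h : ∫⁻ x in Ioc 0 ((a + b) / 2), ENNReal.ofReal ((b - a) / r * Real.exp (-((b - a) / r))) *
        ENNReal.ofReal (Real.exp (-(2 / r * ((a + b) / 2 - x))))
      ≤ ∫⁻ x in Icc 0 ℓ, ENNReal.ofReal (2 / r * ((b - a) / 2 + |x - (a + b) / 2|) *
        Real.exp (-(2 / r * ((b - a) / 2 + |x - (a + b) / 2|)))) := by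
    refine le_trans ?_ (lintegral_mono_set
      (show Ioc 0 ((a + b) / 2) ⊆ Icc 0 ℓ from fun x hx => ⟨hx.1.le, by linarith [hx.2]⟩))
    refine setLIntegral_mono' measurableSet_Ioc fun x hx => ?_
    have hba : 0 ≤ (b - a) / r := div_nonneg (by linarith) hr.le
    rw [← ENNReal.ofReal_mul (by positivity), abs_of_nonpos (by linarith [hx.2])]
    refine ENNReal.ofReal_le_ofReal ?_
    rw [mul_assoc, ← Real.exp_add]
    have e : -((b - a) / r) + -(2 / r * ((a + b) / 2 - x))
        = -(2 / r * ((b - a) / 2 + -(x - (a + b) / 2))) := by ring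
    rw [e]
    refine mul_le_mul_of_nonneg_right ?_ (Real.exp_pos _).le
    have h2 : 0 ≤ 2 / r * (-(x - (a + b) / 2)) := by
      have : 0 ≤ -(x - (a + b) / 2) := by linarith [hx.2]
      positivity
    have e2 : 2 / r * ((b - a) / 2 + -(x - (a + b) / 2))
        = (b - a) / r + 2 / r * (-(x - (a + b) / 2)) := by ring
    linarith
  refine le_trans ?_ (mul_le_mul_right h 2)
  have hba : 0 ≤ (b - a) / r := div_nonneg (by linarith) hr.le
  rw [lintegral_const_mul _ (by fun_prop), lintegral_exp_neg_left hr (by linarith),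
    ← ENNReal.ofReal_mul (by positivity), ← ENNReal.ofReal_ofNat 2,
    ← ENNReal.ofReal_mul (by norm_num)]
  refine (congrArg _ ?_).le
  rw [mul_div_cancel₀ _ (two_ne_zero)]
  field_simp

/-- The influence of a ball with uniform centre, up to normalization, bounded above. -/
lemma lintegral_uniform_le (hr : 0 < r) (hab : a ≤ b) :
    ∫⁻ x in Icc 0 ℓ, ENNReal.ofReal (2 / r * ((b - a) / 2 + |x - (a + b) / 2|) *
        Real.exp (-(2 / r * ((b - a) / 2 + |x - (a + b) / 2|)))) ≤ ENNReal.ofReal (2 * r) := by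
  have h := lintegral_exp_neg_abs (one_div_pos.2 hr) ((a + b) / 2)
  rw [div_div_eq_mul_div, div_one] at h
  rw [← h]
  refine (setLIntegral_le_lintegral _ _).trans (lintegral_mono fun x => ?_)
  refine ENNReal.ofReal_le_ofReal ?_
  set y := |x - (a + b) / 2| with hy
  have hy0 : 0 ≤ y := abs_nonneg _
  set u := 1 / r * ((b - a) / 2 + y) with hu
  have hu2 : 2 / r * ((b - a) / 2 + y) = 2 * u := by rw [hu]; ring
  have hu0 : 0 ≤ u := by
    have : 0 ≤ (b - a) / 2 + y := by linarith
    positivity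
  have huy : 1 / r * y ≤ u := by
    rw [hu]
    have : 0 < 1 / r := by positivity
    nlinarith
  rw [hu2]
  -- `2 * u ≤ exp u`, so that half of the exponential decay absorbs the linear factor
  have h1 : 2 * u ≤ Real.exp u := by
    have h2 := Real.add_one_le_exp (u / 2)
    have h3 : Real.exp u = Real.exp (u / 2) ^ 2 := by
      rw [← Real.exp_nat_mul]; congr 1; push_cast; ring
    have h4 : (u / 2 + 1) ^ 2 ≤ Real.exp (u / 2) ^ 2 := pow_le_pow_left₀ (by linarith) h2 2
    nlinarith [sq_nonneg (u / 2 - 1)]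
  calc 2 * u * Real.exp (-(2 * u)) ≤ Real.exp u * Real.exp (-(2 * u)) :=
        mul_le_mul_of_nonneg_right h1 (Real.exp_pos _).le
    _ = Real.exp (-u) := by rw [← Real.exp_add]; congr 1; ring
    _ ≤ Real.exp (-(1 / r * y)) := Real.exp_le_exp.2 (by linarith)

/-- The probability that a ball with uniform centre covers the hull `[a, b]`, up to
normalization. -/
lemma lintegral_cover_uniform_le (hr : 0 < r) :
    ∫⁻ x in Icc 0 ℓ, ENNReal.ofReal (Real.exp (-(2 / r * ((b - a) / 2 + |x - (a + b) / 2|))))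
      ≤ ENNReal.ofReal r * ENNReal.ofReal (Real.exp (-((b - a) / r))) := by
  have h := lintegral_exp_neg_abs (k := 2 / r) (by positivity) ((a + b) / 2)
  have e : 2 / (2 / r) = r := by field_simp
  rw [e] at h
  rw [mul_comm, ← h, ← lintegral_const_mul _ (by fun_prop)]
  refine (setLIntegral_le_lintegral _ _).trans (lintegral_mono fun x => ?_)
  simp only
  rw [← ENNReal.ofReal_mul (Real.exp_pos _).le, ← Real.exp_add]
  refine (congrArg _ ?_).le
  congr 1
  ring

end Integrals

/-! ### The effect of one more internal point -/

section

/-- The mean of `exp (-(b - a) / r)`, where `[a, b]` is the hull of the uncovered part, on the event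
that the segment is not covered. -/
noncomputable def leftover (ℓ : ℝ) (n : ℕ) (r : ℝ) : ENNReal :=
  ∫⁻ ω, {ω : Fin (n + 2) → ℝ × ℝ | (gap ℓ (region ω)).Nonempty}.indicator
    (fun ω => ENNReal.ofReal (Real.exp (-((gapSup ℓ (region ω) - gapInf ℓ (region ω)) / r)))) ω
      ∂modelLaw ℓ n r

/-- The influence of the `j`-th ball of the model with `n` internal points. -/
noncomputable def modelInfluence (ℓ : ℝ) (n : ℕ) (r : ℝ) (j : Fin (n + 2)) : ENNReal :=
  influence ℓ (fun i : Fin (n + 2) => centreLaw ℓ i) (fun i : Fin (n + 2) => rate i) r j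

variable {ℓ r : ℝ}

lemma lintegral_uniform (hℓ : 0 < ℓ) (f : ℝ → ENNReal) :
    ∫⁻ x, f x ∂(volume : Measure ℝ)[|Icc 0 ℓ] = ENNReal.ofReal (1 / ℓ) * ∫⁻ x in Icc 0 ℓ, f x := by
  rw [ProbabilityTheory.cond, lintegral_smul_measure, Real.volume_Icc, sub_zero, one_div,
    ENNReal.ofReal_inv_of_pos hℓ, smul_eq_mul]

lemma leftover_le_one (hℓ : 0 < ℓ) (n : ℕ) (hr : 0 < r) : leftover ℓ n r ≤ 1 := by
  have := isProbabilityMeasure_modelLaw hℓ n hr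
  refine (lintegral_mono (g := 1) fun ω => ?_).trans (by simp)
  refine indicator_le (fun ω _ => ?_) ω
  rw [Pi.one_apply, ENNReal.ofReal_le_one, Real.exp_le_one_iff]
  have := gapInf_le_gapSup (ℓ := ℓ) (K := region ω)
  have : 0 ≤ (gapSup ℓ (region ω) - gapInf ℓ (region ω)) / r := div_nonneg (by linarith) hr.le
  linarith

/-- With its last internal point removed, the model with `n + 1` internal points becomes the model
with `n` of them. -/
lemma modelLaw_succ_covered (hℓ : 0 < ℓ) (n : ℕ) (hr : 0 < r) :
    modelLaw ℓ (n + 1) r {ω | Icc 0 ℓ ⊆ region ω} = modelLaw ℓ n r {ω | Icc 0 ℓ ⊆ region ω} +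
      ∫⁻ p, {p : (Fin (n + 2) → ℝ × ℝ) × ℝ | (gap ℓ (region p.1)).Nonempty}.indicator
        (fun p => ENNReal.ofReal (Real.exp (-(2 / r * reach ℓ (region p.1) p.2)))) p
          ∂((modelLaw ℓ n r).prod ((volume : Measure ℝ)[|Icc 0 ℓ])) := by
  have h2 := fun i : Fin (n + 3) => isProbabilityMeasure_centreLaw hℓ i
  have h := cfgLaw_covered_eq (ν := fun i : Fin (n + 3) => centreLaw ℓ i)
    (w := fun i : Fin (n + 3) => rate i) hℓ (fun i => rate_pos i) hr (Fin.last (n + 2))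
  have e1 : restLaw (fun i : Fin (n + 3) => centreLaw ℓ i) (fun i : Fin (n + 3) => rate i) r
      (Fin.last (n + 2)) = modelLaw ℓ n r := by
    simp only [restLaw, modelLaw, Fin.succAbove_last, Fin.val_castSucc]
  have e2 : centreLaw ℓ (Fin.last (n + 2)) = (volume : Measure ℝ)[|Icc 0 ℓ] := by
    simp [centreLaw]
  have e3 : rate (Fin.last (n + 2)) = 2 := by simp [rate]
  rw [e1, e2, e3] at h
  exact h

lemma lintegral_completing_le (hℓ : 0 < ℓ) (n : ℕ) (hr : 0 < r) :
    ENNReal.ofReal ℓ *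
      ∫⁻ p, {p : (Fin (n + 2) → ℝ × ℝ) × ℝ | (gap ℓ (region p.1)).Nonempty}.indicator
        (fun p => ENNReal.ofReal (Real.exp (-(2 / r * reach ℓ (region p.1) p.2)))) p
          ∂((modelLaw ℓ n r).prod ((volume : Measure ℝ)[|Icc 0 ℓ]))
      ≤ ENNReal.ofReal r * leftover ℓ n r := by
  have := isProbabilityMeasure_modelLaw hℓ n hr
  have := isProbabilityMeasure_uniform hℓ
  have hm := measurable_reach_region (m := n + 2) hℓ
  rw [lintegral_prod _ (measurable_gap_indicator hℓ (by fun_prop)).aemeasurable,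
    ← lintegral_const_mul' _ _ ENNReal.ofReal_ne_top, leftover,
    ← lintegral_const_mul' _ _ ENNReal.ofReal_ne_top]
  refine lintegral_mono fun ω => ?_
  by_cases h : (gap ℓ (region ω)).Nonempty
  · have e : ∀ x : ℝ, {p : (Fin (n + 2) → ℝ × ℝ) × ℝ | (gap ℓ (region p.1)).Nonempty}.indicator
        (fun p => ENNReal.ofReal (Real.exp (-(2 / r * reach ℓ (region p.1) p.2)))) (ω, x)
        = ENNReal.ofReal (Real.exp (-(2 / r * ((gapSup ℓ (region ω) - gapInf ℓ (region ω)) / 2 +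
          |x - (gapInf ℓ (region ω) + gapSup ℓ (region ω)) / 2|)))) := by
      intro x
      rw [indicator_of_mem (by exact h), reach_eq]
    simp_rw [e]
    rw [indicator_of_mem (by exact h), lintegral_uniform hℓ, ← mul_assoc,
      ← ENNReal.ofReal_mul hℓ.le, mul_one_div_cancel hℓ.ne', ENNReal.ofReal_one, one_mul]
    exact lintegral_cover_uniform_le hr
  · have e : ∀ x : ℝ, {p : (Fin (n + 2) → ℝ × ℝ) × ℝ | (gap ℓ (region p.1)).Nonempty}.indicator
        (fun p => ENNReal.ofReal (Real.exp (-(2 / r * reach ℓ (region p.1) p.2)))) (ω, x) = 0 :=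
      fun x => indicator_of_notMem (by exact h) _
    simp [e]

lemma coverProbGiven_le_succ (hℓ : 0 < ℓ) (n : ℕ) (hr : 0 < r) :
    coverProbGiven ℓ n r ≤ coverProbGiven ℓ (n + 1) r := by
  have := isProbabilityMeasure_modelLaw hℓ (n + 1) hr
  unfold coverProbGiven
  refine ENNReal.toReal_mono (measure_ne_top _ _) ?_
  rw [modelLaw_succ_covered hℓ n hr]
  exact le_self_add

lemma ofReal_coverProbGiven_sub (hℓ : 0 < ℓ) (n : ℕ) (hr : 0 < r) :
    ENNReal.ofReal (coverProbGiven ℓ (n + 1) r - coverProbGiven ℓ n r)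
      = ∫⁻ p, {p : (Fin (n + 2) → ℝ × ℝ) × ℝ | (gap ℓ (region p.1)).Nonempty}.indicator
        (fun p => ENNReal.ofReal (Real.exp (-(2 / r * reach ℓ (region p.1) p.2)))) p
          ∂((modelLaw ℓ n r).prod ((volume : Measure ℝ)[|Icc 0 ℓ])) := by
  have h1 := isProbabilityMeasure_modelLaw hℓ n hr
  have h2 := isProbabilityMeasure_modelLaw hℓ (n + 1) hr
  unfold coverProbGiven
  rw [ENNReal.ofReal_sub _ measureReal_nonneg, ofReal_measureReal, ofReal_measureReal,
    modelLaw_succ_covered hℓ n hr, ENNReal.add_sub_cancel_left (measure_ne_top _ _)]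

/-- Two balls at the ends of the segment fail to cover it with positive probability, so an internal
point increases the covering probability strictly. -/
lemma coverProbGiven_zero_lt_one (hℓ : 0 < ℓ) (hr : 0 < r) :
    coverProbGiven ℓ 0 r < coverProbGiven ℓ 1 r := by
  have h1 := isProbabilityMeasure_modelLaw hℓ 0 hr
  have h2 := isProbabilityMeasure_uniform hℓ
  have h3 := fun i : Fin (0 + 2) => isProbabilityMeasure_centreLaw hℓ i
  have h4 := fun i : Fin (0 + 2) => isProbabilityMeasure_expMeasure (div_pos (rate_pos i) hr)
  have hm := measurable_reach_region (m := 0 + 2) hℓ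
  rw [← sub_pos, ← ENNReal.ofReal_pos, ofReal_coverProbGiven_sub hℓ 0 hr,
    lintegral_pos_iff_support (measurable_gap_indicator hℓ (by fun_prop))]
  have hsupp : Function.support
      ({p : (Fin (0 + 2) → ℝ × ℝ) × ℝ | (gap ℓ (region p.1)).Nonempty}.indicator
        (fun p => ENNReal.ofReal (Real.exp (-(2 / r * reach ℓ (region p.1) p.2)))))
      = {ω : Fin (0 + 2) → ℝ × ℝ | (gap ℓ (region ω)).Nonempty} ×ˢ univ := by
    ext p
    by_cases h : (gap ℓ (region p.1)).Nonempty <;> simp [h, Real.exp_pos]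
  rw [hsupp, Measure.prod_prod, measure_univ, mul_one]
  set s : Fin (0 + 2) → Set (ℝ × ℝ) :=
    fun i => {if (i : ℕ) = 0 then 0 else ℓ} ×ˢ Iio (ℓ / 2) with hs
  have hsub : univ.pi s ⊆ {ω : Fin (0 + 2) → ℝ × ℝ | (gap ℓ (region ω)).Nonempty} := by
    intro ω hω
    refine ⟨ℓ / 2, ⟨by linarith, by linarith⟩, fun h => ?_⟩
    obtain ⟨i, hi⟩ := mem_iUnion.1 h
    have h5 := hω i (mem_univ i)
    have h6 : (ω i).1 = if (i : ℕ) = 0 then 0 else ℓ := h5.1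
    have h7 : (ω i).2 < ℓ / 2 := h5.2
    have h8 := hi.1
    have h9 := hi.2
    rw [h6] at h8 h9
    split_ifs at h8 h9 <;> linarith
  refine lt_of_lt_of_le ?_ (measure_mono hsub)
  rw [modelLaw, cfgLaw, Measure.pi_pi]
  refine pos_iff_ne_zero.2 (Finset.prod_ne_zero_iff.2 fun i _ => ?_)
  rw [hs, Measure.prod_prod]
  refine mul_ne_zero ?_ ?_
  · have : (i : ℕ) = 0 ∨ (i : ℕ) = 1 := by omega
    rcases this with h | h <;> simp [centreLaw, h]
  · have hc := div_pos (rate_pos i) hr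
    rw [← compl_Ici, Ne, prob_compl_eq_zero_iff measurableSet_Ici, expMeasure_Ici hc (by linarith),
      ENNReal.ofReal_eq_one, Real.exp_eq_one_iff]
    have : 0 < rate i / r * (ℓ / 2) := by positivity
    linarith

end

/-! ### The comparison for a fixed number of internal points -/

section

variable {ℓ r : ℝ}

/-- The configurations of a remaining family of balls, a centre and a radius for which the right end
of the corresponding ball can be the left end of the uncovered hull. -/
def leftNeighbour (m : ℕ) (ℓ : ℝ) : Set (((Fin m → ℝ × ℝ) × ℝ) × ℝ) :=
  {q | (gap ℓ (region q.1.1)).Nonempty ∧ q.1.2 - q.2 ≤ gapInf ℓ (region q.1.1) ∧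
    gapInf ℓ (region q.1.1) ≤ q.1.2 + q.2 ∧ q.1.2 + q.2 ≤ gapSup ℓ (region q.1.1)}

/-- The factor `exp (-(b - a) / r)` of the full family, in terms of the remaining family and of the
ball whose right end is `a`. -/
noncomputable def leftWeight (m : ℕ) (ℓ r : ℝ) : ((Fin m → ℝ × ℝ) × ℝ) × ℝ → ENNReal :=
  (leftNeighbour m ℓ).indicator fun q =>
    ENNReal.ofReal (Real.exp (-((gapSup ℓ (region q.1.1) - (q.1.2 + q.2)) / r)))

lemma measurable_leftWeight (m : ℕ) (hℓ : 0 < ℓ) : Measurable (leftWeight m ℓ r) := by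
  have hq : Measurable fun q : ((Fin m → ℝ × ℝ) × ℝ) × ℝ => q.1.1 := by fun_prop
  have ha := (measurable_gapInf_region (m := m) hℓ).comp hq
  have hb := (measurable_gapSup_region (m := m) hℓ).comp hq
  simp only [Function.comp_def] at ha hb
  refine Measurable.indicator (by fun_prop) ?_
  simp only [leftNeighbour, Set.ofPred_and]
  exact (hq (measurableSet_gap_region hℓ)).inter ((measurableSet_le (by fun_prop) ha).inter
    ((measurableSet_le ha (by fun_prop)).inter (measurableSet_le (by fun_prop) hb)))

lemma leftWeight_eq {m : ℕ} {ω : Fin m → ℝ × ℝ} (h : (gap ℓ (region ω)).Nonempty) (x s : ℝ) :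
    leftWeight m ℓ r ((ω, x), s)
      = {s | x - s ≤ gapInf ℓ (region ω) ∧ gapInf ℓ (region ω) ≤ x + s ∧
          x + s ≤ gapSup ℓ (region ω)}.indicator
        (fun s => ENNReal.ofReal (Real.exp (-((gapSup ℓ (region ω) - (x + s)) / r)))) s := by
  by_cases hs : x - s ≤ gapInf ℓ (region ω) ∧ gapInf ℓ (region ω) ≤ x + s ∧
      x + s ≤ gapSup ℓ (region ω)
  · rw [leftWeight, indicator_of_mem (show ((ω, x), s) ∈ leftNeighbour m ℓ from ⟨h, hs⟩),
      indicator_of_mem (by exact hs)]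
  · rw [leftWeight, indicator_of_notMem (fun h' => hs h'.2), indicator_of_notMem (by exact hs)]

lemma leftWeight_eq_zero {m : ℕ} {ω : Fin m → ℝ × ℝ} (h : ¬ (gap ℓ (region ω)).Nonempty) (x s : ℝ) :
    leftWeight m ℓ r ((ω, x), s) = 0 := indicator_of_notMem (fun h' => h h'.1) _

lemma ae_left_end_covered (hℓ : 0 < ℓ) (n : ℕ) (hr : 0 < r) :
    ∀ᵐ ω ∂modelLaw ℓ n r, 0 ∈ region ω := by
  have h3 := fun i : Fin (n + 2) => isProbabilityMeasure_centreLaw hℓ i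
  have h4 := fun i : Fin (n + 2) => isProbabilityMeasure_expMeasure (div_pos (rate_pos i) hr)
  have h : ∀ᵐ z ∂(centreLaw ℓ ((0 : Fin (n + 2)) : ℕ)).prod
      (expMeasure (rate ((0 : Fin (n + 2)) : ℕ) / r)), 0 ∈ interval z := by
    have e : centreLaw ℓ ((0 : Fin (n + 2)) : ℕ) = Measure.dirac 0 := by simp [centreLaw]
    have h4' := h4 0
    rw [e, Measure.dirac_prod]
    refine (ae_map_iff (by fun_prop) ?_).2 ?_
    · simp only [interval, mem_Icc, Set.ofPred_and]
      exact (measurableSet_le (by fun_prop) measurable_const).inter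
        (measurableSet_le measurable_const (by fun_prop))
    · filter_upwards [ae_pos_expMeasure (rate ((0 : Fin (n + 2)) : ℕ) / r)] with s hs
      constructor <;> simp [hs.le]
  have h' := (measurePreserving_eval (fun i : Fin (n + 2) =>
    (centreLaw ℓ i).prod (expMeasure (rate i / r))) 0).quasiMeasurePreserving.ae h
  filter_upwards [h'] with ω hω
  exact mem_iUnion.2 ⟨0, hω⟩

lemma modelInfluence_eq (hℓ : 0 < ℓ) (n : ℕ) (j : Fin (n + 2)) :
    modelInfluence ℓ n r j = ∫⁻ ω, {ω | (gap ℓ (region ω)).Nonempty}.indicator (fun ω =>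
        ∫⁻ x, ENNReal.ofReal (rate j / r * reach ℓ (region ω) x *
          Real.exp (-(rate j / r * reach ℓ (region ω) x))) ∂centreLaw ℓ j) ω
      ∂restLaw (fun i : Fin (n + 2) => centreLaw ℓ i) (fun i : Fin (n + 2) => rate i) r j := by
  have h3 := fun i : Fin (n + 2) => isProbabilityMeasure_centreLaw hℓ i
  have hm := measurable_reach_region (m := n + 1) hℓ
  rw [modelInfluence, influence, lintegral_prod _
    (measurable_gap_indicator hℓ (by fun_prop)).aemeasurable]
  refine lintegral_congr fun ω => ?_
  by_cases h : (gap ℓ (region ω)).Nonempty <;> simp [h]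

/-- For fixed positions of the other balls, the weight of the ball ending at the left of the
uncovered hull is at most twice its influence. -/
lemma lintegral_leftWeight_le_aux (hℓ : 0 < ℓ) (n : ℕ) (hr : 0 < r) (j : Fin (n + 2))
    {ω : Fin (n + 1) → ℝ × ℝ} (h : (gap ℓ (region ω)).Nonempty) :
    ∫⁻ x, ∫⁻ s, leftWeight (n + 1) ℓ r ((ω, x), s) ∂expMeasure (rate j / r) ∂centreLaw ℓ j
      ≤ 2 * ∫⁻ x, ENNReal.ofReal (rate j / r * reach ℓ (region ω) x *
          Real.exp (-(rate j / r * reach ℓ (region ω) x))) ∂centreLaw ℓ j := by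
  have hab := gapInf_le_gapSup (ℓ := ℓ) (K := region ω)
  have ha := gapInf_nonneg (ℓ := ℓ) (K := region ω)
  have hb := gapSup_le (K := region ω) hℓ.le
  simp_rw [leftWeight_eq h]
  by_cases h0 : (j : ℕ) = 0
  · have e1 : centreLaw ℓ j = Measure.dirac 0 := by simp [centreLaw, h0]
    have e2 : rate j = 1 := by simp [rate, h0]
    have e3 : reach ℓ (region ω) 0 = gapSup ℓ (region ω) := by
      rw [reach, max_eq_right (by linarith)]; ring
    rw [e1, e2, lintegral_dirac, lintegral_dirac, e3]
    refine (lintegral_left_zero_le hr (ha.trans hab)).trans ?_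
    rw [one_div_mul_eq_div]
    exact le_mul_of_one_le_left' (by norm_num)
  by_cases h1 : (j : ℕ) = 1
  · have e1 : centreLaw ℓ j = Measure.dirac ℓ := by simp [centreLaw, h1]
    rw [e1, lintegral_dirac]
    refine le_trans (le_of_eq ?_) zero_le
    rw [lintegral_eq_zero_iff' ?_]
    · filter_upwards [ae_pos_expMeasure (rate j / r)] with s hs
      exact indicator_of_notMem (fun h' => by linarith [h'.2.2]) _
    · refine (Measurable.indicator (by fun_prop) ?_).aemeasurable
      simp only [Set.ofPred_and]
      exact (measurableSet_le (by fun_prop) measurable_const).inter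
        ((measurableSet_le measurable_const (by fun_prop)).inter
          (measurableSet_le (by fun_prop) measurable_const))
  · have e1 : centreLaw ℓ j = (volume : Measure ℝ)[|Icc 0 ℓ] := by simp [centreLaw, h0, h1]
    have e2 : rate j = 2 := by
      have : ¬ (j : ℕ) < 2 := by omega
      simp [rate, this]
    rw [e1, e2, lintegral_uniform hℓ, lintegral_uniform hℓ, mul_left_comm]
    refine mul_le_mul_right ?_ _
    refine (lintegral_left_uniform_le hr ha hab).trans ?_
    simp_rw [reach_eq]
    exact le_lintegral_uniform hr ha hab hb

/-- A configuration that does not cover is charged to the ball ending at the left of its uncovered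
hull; a ball is charged at most twice its influence. -/
lemma leftover_le_sum_modelInfluence (hℓ : 0 < ℓ) (n : ℕ) (hr : 0 < r) :
    leftover ℓ n r ≤ 2 * ∑ j, modelInfluence ℓ n r j := by
  have h3 := fun i : Fin (n + 2) => isProbabilityMeasure_centreLaw hℓ i
  have h4 := fun i : Fin (n + 2) => isProbabilityMeasure_expMeasure (div_pos (rate_pos i) hr)
  have hsplit := fun j : Fin (n + 2) => measurePreserving_split
    (ν := fun i : Fin (n + 2) => centreLaw ℓ i) (w := fun i : Fin (n + 2) => rate i)
    (fun i => rate_pos i) hr j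
  have hR := fun j : Fin (n + 2) => isProbabilityMeasure_restLaw
    (ν := fun i : Fin (n + 2) => centreLaw ℓ i) (w := fun i : Fin (n + 2) => rate i)
    (fun i => rate_pos i) hr j
  have hle : leftover ℓ n r ≤ ∫⁻ ω, ∑ j : Fin (n + 2), leftWeight (n + 1) ℓ r
      (((fun i => ω (j.succAbove i)), (ω j).1), (ω j).2) ∂modelLaw ℓ n r := by
    refine lintegral_mono_ae ?_
    filter_upwards [ae_left_end_covered hℓ n hr] with ω hω
    by_cases h : (gap ℓ (region ω)).Nonempty
    · obtain ⟨j, hj, hsup, hend, hleft, hright⟩ := exists_left_neighbour ω h hω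
      rw [indicator_of_mem (by exact h)]
      refine le_trans (le_of_eq ?_) (Finset.single_le_sum (fun _ _ => zero_le) (Finset.mem_univ j))
      have hmem : (((fun i => ω (j.succAbove i)), (ω j).1), (ω j).2) ∈ leftNeighbour (n + 1) ℓ := by
        refine ⟨hj, hleft, hright, ?_⟩
        simp only
        rw [hsup, hend]
        exact gapInf_le_gapSup
      rw [leftWeight, indicator_of_mem hmem]
      simp only
      rw [hsup, hend]
    · rw [indicator_of_notMem (by exact h)]
      exact zero_le
  have hsum := lintegral_finsetSum (μ := modelLaw ℓ n r)
    (f := fun (j : Fin (n + 2)) (ω : Fin (n + 2) → ℝ × ℝ) => leftWeight (n + 1) ℓ r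
      (((fun i => ω (j.succAbove i)), (ω j).1), (ω j).2)) Finset.univ fun j _ =>
      (measurable_leftWeight (n + 1) hℓ).comp (hsplit j).measurable
  refine (hle.trans_eq hsum).trans ?_
  rw [Finset.mul_sum]
  refine Finset.sum_le_sum fun j _ => ?_
  rw [modelLaw, (hsplit j).lintegral_comp (measurable_leftWeight (n + 1) hℓ),
    lintegral_prod _ (measurable_leftWeight (n + 1) hℓ).aemeasurable,
    lintegral_prod _ (measurable_leftWeight (n + 1) hℓ).lintegral_prod_right'.aemeasurable,
    modelInfluence_eq hℓ n, ← lintegral_const_mul' _ _ (by norm_num)]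
  refine lintegral_mono fun ω => ?_
  by_cases h : (gap ℓ (region ω)).Nonempty
  · rw [indicator_of_mem (by exact h)]
    exact lintegral_leftWeight_le_aux hℓ n hr j h
  · simp [leftWeight_eq_zero h]

lemma modelInfluence_le_one (hℓ : 0 < ℓ) (n : ℕ) (hr : 0 < r) (j : Fin (n + 2)) :
    modelInfluence ℓ n r j ≤ 1 := by
  have h3 := fun i : Fin (n + 2) => isProbabilityMeasure_centreLaw hℓ i
  exact influence_le_one (fun i => rate_pos i) hr j

lemma modelInfluence_internal_le (hℓ : 0 < ℓ) (n : ℕ) (hr : 0 < r) (j : Fin n) :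
    modelInfluence ℓ n r j.succ.succ ≤ ENNReal.ofReal (2 * r / ℓ) := by
  have h3 := fun i : Fin (n + 2) => isProbabilityMeasure_centreLaw hℓ i
  have hR := isProbabilityMeasure_restLaw
    (ν := fun i : Fin (n + 2) => centreLaw ℓ i) (w := fun i : Fin (n + 2) => rate i)
    (fun i => rate_pos i) hr j.succ.succ
  rw [modelInfluence_eq hℓ n]
  refine (lintegral_mono (g := fun _ => ENNReal.ofReal (2 * r / ℓ)) fun ω => ?_).trans (by simp)
  refine indicator_le (g := fun _ => ENNReal.ofReal (2 * r / ℓ)) (fun ω _ => ?_) ω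
  have e1 : centreLaw ℓ (j.succ.succ : Fin (n + 2)) = (volume : Measure ℝ)[|Icc 0 ℓ] := by
    simp [centreLaw]
  have e2 : rate (j.succ.succ : Fin (n + 2)) = 2 := by simp [rate]
  rw [e1, e2, lintegral_uniform hℓ]
  simp_rw [reach_eq]
  refine (mul_le_mul_right (lintegral_uniform_le hr gapInf_le_gapSup) _).trans ?_
  rw [← ENNReal.ofReal_mul (by positivity), one_div_mul_eq_div]

/-- The derivative in `r` of the covering probability with `n` internal points. -/
noncomputable def coverProbGivenDeriv (ℓ : ℝ) (n : ℕ) (r : ℝ) : ℝ :=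
  1 / r * ∑ j, (modelInfluence ℓ n r j).toReal

lemma hasDerivAt_coverProbGiven (hℓ : 0 < ℓ) (n : ℕ) (hr : 0 < r) :
    HasDerivAt (coverProbGiven ℓ n) (coverProbGivenDeriv ℓ n r) r := by
  have h3 := fun i : Fin (n + 2) => isProbabilityMeasure_centreLaw hℓ i
  exact hasDerivAt_covered (ν := fun i : Fin (n + 2) => centreLaw ℓ i)
    (w := fun i : Fin (n + 2) => rate i) hℓ (fun i => rate_pos i) hr

lemma coverProbGivenDeriv_nonneg (n : ℕ) (hr : 0 < r) : 0 ≤ coverProbGivenDeriv ℓ n r :=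
  mul_nonneg (by positivity) (Finset.sum_nonneg fun _ _ => ENNReal.toReal_nonneg)

lemma toReal_modelInfluence_le_one (hℓ : 0 < ℓ) (n : ℕ) (hr : 0 < r) (j : Fin (n + 2)) :
    (modelInfluence ℓ n r j).toReal ≤ 1 :=
  ENNReal.toReal_le_of_le_ofReal zero_le_one (by simpa using modelInfluence_le_one hℓ n hr j)

lemma coverProbGivenDeriv_le (hℓ : 0 < ℓ) (n : ℕ) (hr : 0 < r) :
    coverProbGivenDeriv ℓ n r ≤ (n + 2) / r := by
  have h : ∑ j, (modelInfluence ℓ n r j).toReal ≤ ∑ _j : Fin (n + 2), (1 : ℝ) :=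
    Finset.sum_le_sum fun j _ => toReal_modelInfluence_le_one hℓ n hr j
  simp only [Finset.sum_const, Finset.card_univ, Fintype.card_fin, nsmul_eq_mul, mul_one] at h
  push_cast at h
  rw [coverProbGivenDeriv, one_div_mul_eq_div]
  gcongr

/-- For long segments the influence of an internal point is of order `r / ℓ`. -/
lemma coverProbGivenDeriv_le' (hℓ : 0 < ℓ) (n : ℕ) (hr : 0 < r) :
    coverProbGivenDeriv ℓ n r ≤ 2 / r + 2 * n / ℓ := by
  have h0 := toReal_modelInfluence_le_one hℓ n hr 0
  have h1 := toReal_modelInfluence_le_one hℓ n hr (Fin.succ 0)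
  have h2 : ∑ j : Fin n, (modelInfluence ℓ n r j.succ.succ).toReal ≤ ∑ _j : Fin n, 2 * r / ℓ :=
    Finset.sum_le_sum fun j _ => ENNReal.toReal_le_of_le_ofReal (by positivity)
      (modelInfluence_internal_le hℓ n hr j)
  simp only [Finset.sum_const, Finset.card_univ, Fintype.card_fin, nsmul_eq_mul] at h2
  rw [coverProbGivenDeriv, Fin.sum_univ_succ, Fin.sum_univ_succ]
  have h3 : 2 / r + 2 * n / ℓ = 1 / r * (1 + (1 + n * (2 * r / ℓ))) := by field_simp; ring
  rw [h3]
  gcongr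

lemma mul_coverProbGiven_sub_le_leftover (hℓ : 0 < ℓ) (n : ℕ) (hr : 0 < r) :
    ENNReal.ofReal (ℓ * (coverProbGiven ℓ (n + 1) r - coverProbGiven ℓ n r))
      ≤ ENNReal.ofReal r * leftover ℓ n r := by
  rw [ENNReal.ofReal_mul hℓ.le, ofReal_coverProbGiven_sub hℓ n hr]
  exact lintegral_completing_le hℓ n hr

lemma mul_coverProbGiven_sub_le (hℓ : 0 < ℓ) (n : ℕ) (hr : 0 < r) :
    ℓ * (coverProbGiven ℓ (n + 1) r - coverProbGiven ℓ n r) ≤ r := by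
  rw [← ENNReal.ofReal_le_ofReal_iff hr.le]
  exact (mul_coverProbGiven_sub_le_leftover hℓ n hr).trans
    (mul_le_of_le_one_right' (leftover_le_one hℓ n hr))

/-- The comparison of the two derivatives, for each number of internal points. -/
lemma mul_coverProbGiven_sub_le_deriv (hℓ : 0 < ℓ) (n : ℕ) (hr : 0 < r) :
    ℓ * (coverProbGiven ℓ (n + 1) r - coverProbGiven ℓ n r)
      ≤ 2 * r ^ 2 * coverProbGivenDeriv ℓ n r := by
  have hd := coverProbGivenDeriv_nonneg (ℓ := ℓ) n hr
  rw [← ENNReal.ofReal_le_ofReal_iff (by positivity)]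
  refine (mul_coverProbGiven_sub_le_leftover hℓ n hr).trans
    ((mul_le_mul_right (leftover_le_sum_modelInfluence hℓ n hr) _).trans (le_of_eq ?_))
  have hfin : ∀ j, modelInfluence ℓ n r j ≠ ⊤ := fun j =>
    ne_top_of_le_ne_top ENNReal.one_ne_top (modelInfluence_le_one hℓ n hr j)
  have hsum : ∑ j, modelInfluence ℓ n r j
      = ENNReal.ofReal (∑ j, (modelInfluence ℓ n r j).toReal) := by
    rw [ENNReal.ofReal_sum_of_nonneg fun _ _ => ENNReal.toReal_nonneg]
    exact Finset.sum_congr rfl fun j _ => (ENNReal.ofReal_toReal (hfin j)).symm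
  rw [hsum, ← ENNReal.ofReal_ofNat 2, ← ENNReal.ofReal_mul (by norm_num),
    ← ENNReal.ofReal_mul hr.le, coverProbGivenDeriv]
  congr 1
  field_simp

end

/-! ### Poisson series -/

section

section PoissonSeries

open Filter Topology

lemma summable_pow_div_factorial_mul {g : ℕ → ℝ} {A B : ℝ} (hg : ∀ n, |g n| ≤ A + B * n) (x : ℝ) :
    Summable fun n : ℕ => x ^ n / n.factorial * g n := by
  have h1 : Summable fun n : ℕ => |x| ^ n / n.factorial := Real.summable_pow_div_factorial |x|
  have h2 : Summable fun n : ℕ => |x| ^ n / n.factorial * (n : ℝ) := by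
    rw [← summable_nat_add_iff 1]
    refine (h1.mul_left |x|).congr fun n => ?_
    rw [Nat.factorial_succ]
    push_cast
    field_simp
    ring
  refine Summable.of_norm_bounded (g := fun n : ℕ =>
    A * (|x| ^ n / n.factorial) + B * (|x| ^ n / n.factorial * n))
    ((h1.mul_left A).add (h2.mul_left B)) fun n => ?_
  rw [norm_mul, Real.norm_eq_abs, Real.norm_eq_abs, abs_div, abs_pow, Nat.abs_cast]
  have h3 : 0 ≤ |x| ^ n / (n.factorial : ℝ) := by positivity
  nlinarith [mul_le_mul_of_nonneg_left (hg n) h3]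

lemma hasDerivAt_tsum_pow_div_factorial {g : ℕ → ℝ} (hg : ∀ n, |g n| ≤ 1) (x : ℝ) :
    HasDerivAt (fun x : ℝ => ∑' n : ℕ, x ^ n / n.factorial * g n)
      (∑' n : ℕ, x ^ n / n.factorial * g (n + 1)) x := by
  set R := |x| + 1
  have hR : 0 ≤ R := by positivity
  have hu : Summable fun n : ℕ => (n : ℝ) * R ^ (n - 1) / n.factorial := by
    rw [← summable_nat_add_iff 1]
    refine (Real.summable_pow_div_factorial R).congr fun n => ?_
    rw [Nat.factorial_succ, Nat.add_sub_cancel]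
    push_cast
    field_simp
  have hd : ∀ (n : ℕ) (y : ℝ), HasDerivAt (fun y : ℝ => y ^ n / n.factorial * g n)
      (n * y ^ (n - 1) / n.factorial * g n) y :=
    fun n y => ((hasDerivAt_pow n y).div_const _).mul_const _
  have hsum0 : Summable fun n : ℕ => x ^ n / n.factorial * g n :=
    summable_pow_div_factorial_mul (A := 1) (B := 0) (by simpa using hg) x
  have hbound : ∀ (n : ℕ) (y : ℝ), y ∈ Ioo (-R) R →
      ‖(n * y ^ (n - 1) / n.factorial * g n : ℝ)‖ ≤ n * R ^ (n - 1) / n.factorial := by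
    intro n y hy
    have hy' : |y| ≤ R := (abs_lt.2 hy).le
    rw [norm_mul, Real.norm_eq_abs, Real.norm_eq_abs, abs_div, abs_mul, abs_pow, Nat.abs_cast,
      Nat.abs_cast]
    calc _ ≤ (n * |y| ^ (n - 1) / n.factorial : ℝ) * 1 := by gcongr; exact hg n
      _ ≤ _ := by rw [mul_one]; gcongr
  have hx : x ∈ Ioo (-R) R := abs_lt.1 (lt_add_one |x|)
  have h := hasDerivAt_tsum_of_isPreconnected hu isOpen_Ioo isPreconnected_Ioo
    (fun n y _ => hd n y) hbound hx hsum0 hx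
  refine h.congr_deriv ?_
  have hs : Summable fun n : ℕ => (n * x ^ (n - 1) / n.factorial * g n : ℝ) :=
    Summable.of_norm_bounded hu fun n => hbound n x hx
  rw [hs.tsum_eq_zero_add]
  simp only [Nat.cast_zero, zero_mul, zero_div, zero_add]
  refine tsum_congr fun n => ?_
  rw [Nat.factorial_succ, Nat.add_sub_cancel]
  push_cast
  field_simp

end PoissonSeries

variable {ℓ lam r : ℝ}

/-- The Poisson weights. -/
noncomputable def poissonWeight (x : ℝ) (n : ℕ) : ℝ := Real.exp (-x) * (x ^ n / n.factorial)

lemma poissonWeight_nonneg {x : ℝ} (hx : 0 ≤ x) (n : ℕ) : 0 ≤ poissonWeight x n := by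
  unfold poissonWeight
  positivity

lemma summable_poissonWeight_mul {g : ℕ → ℝ} {A B : ℝ} (hg : ∀ n, |g n| ≤ A + B * n) (x : ℝ) :
    Summable fun n : ℕ => poissonWeight x n * g n := by
  refine ((summable_pow_div_factorial_mul hg x).mul_left (Real.exp (-x))).congr fun n => ?_
  rw [poissonWeight, mul_assoc]

lemma tsum_poissonWeight_mul_affine (A B x : ℝ) :
    ∑' n : ℕ, poissonWeight x n * (A + B * n) = A + B * x := by
  have h0 : HasSum (fun n : ℕ => x ^ n / n.factorial) (Real.exp x) := by
    rw [Real.exp_eq_exp_ℝ]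
    exact NormedSpace.expSeries_div_hasSum_exp x
  have h1 : HasSum (fun n : ℕ => x ^ n / n.factorial * n) (x * Real.exp x) := by
    rw [← hasSum_nat_add_iff' 1]
    simp only [Finset.range_one, Finset.sum_singleton, Nat.cast_zero, mul_zero, sub_zero]
    refine (h0.mul_left x).congr_fun fun n => ?_
    rw [Nat.factorial_succ]
    push_cast
    field_simp
    ring
  have h := (((h0.mul_left A).add (h1.mul_left B)).mul_left (Real.exp (-x))).tsum_eq
  have e : ∀ n : ℕ, poissonWeight x n * (A + B * n) = Real.exp (-x) *
      (A * (x ^ n / n.factorial) + B * (x ^ n / n.factorial * n)) := by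
    intro n; rw [poissonWeight]; ring
  simp_rw [e]
  rw [h]
  have h2 : Real.exp (-x) * Real.exp x = 1 := by rw [← Real.exp_add]; simp
  linear_combination (A + B * x) * h2

lemma coverProbGiven_nonneg (n : ℕ) : 0 ≤ coverProbGiven ℓ n r := measureReal_nonneg

lemma coverProbGiven_le_one (hℓ : 0 < ℓ) (n : ℕ) (hr : 0 < r) : coverProbGiven ℓ n r ≤ 1 := by
  have := isProbabilityMeasure_modelLaw hℓ n hr
  exact measureReal_le_one

lemma abs_coverProbGiven_le_one (hℓ : 0 < ℓ) (n : ℕ) (hr : 0 < r) : |coverProbGiven ℓ n r| ≤ 1 := by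
  rw [abs_of_nonneg (coverProbGiven_nonneg n)]
  exact coverProbGiven_le_one hℓ n hr

lemma coverProb_eq_tsum_poissonWeight (hℓ : 0 < ℓ) (hlam : 0 ≤ lam) (hr : 0 < r) :
    coverProb ℓ lam r = ∑' n : ℕ, poissonWeight (lam * ℓ) n * coverProbGiven ℓ n r := by
  rw [coverProb_eq_tsum hℓ hlam hr]
  exact tsum_congr fun n => by rw [poissonWeight, mul_div_assoc]

lemma hasDerivWithinAt_coverProb_lam (hℓ : 0 < ℓ) (hlam : 0 ≤ lam) (hr : 0 < r) :
    HasDerivWithinAt (fun s => coverProb ℓ s r)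
      (∑' n : ℕ, poissonWeight (lam * ℓ) n *
        (ℓ * (coverProbGiven ℓ (n + 1) r - coverProbGiven ℓ n r))) (Ici 0) lam := by
  have hq := fun n => abs_coverProbGiven_le_one (r := r) hℓ n hr
  set f : ℝ → ℝ := fun x => ∑' n : ℕ, x ^ n / n.factorial * coverProbGiven ℓ n r with hf
  have hfun : ∀ s ∈ Ici (0 : ℝ), coverProb ℓ s r = Real.exp (-(s * ℓ)) * f (s * ℓ) := by
    intro s hs
    rw [coverProb_eq_tsum_poissonWeight hℓ hs hr, hf, ← tsum_mul_left]
    exact tsum_congr fun n => by rw [poissonWeight, mul_assoc]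
  have hx : HasDerivAt (fun s : ℝ => s * ℓ) ℓ lam := hasDerivAt_mul_const ℓ
  have h1 : HasDerivAt (fun s : ℝ => f (s * ℓ))
      ((∑' n : ℕ, (lam * ℓ) ^ n / n.factorial * coverProbGiven ℓ (n + 1) r) * ℓ) lam :=
    HasDerivAt.comp (h₂ := f) lam (hasDerivAt_tsum_pow_div_factorial hq (lam * ℓ)) hx
  have h2 := (hx.fun_neg.exp.mul h1).hasDerivWithinAt (s := Ici 0)
  refine (h2.congr hfun (hfun lam hlam)).congr_deriv ?_
  have hs0 : Summable fun n : ℕ => (lam * ℓ) ^ n / n.factorial * coverProbGiven ℓ n r :=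
    summable_pow_div_factorial_mul (A := 1) (B := 0) (by simpa using hq) _
  have hs1 : Summable fun n : ℕ => (lam * ℓ) ^ n / n.factorial * coverProbGiven ℓ (n + 1) r :=
    summable_pow_div_factorial_mul (g := fun n => coverProbGiven ℓ (n + 1) r) (A := 1) (B := 0)
      (by simpa using fun n => hq (n + 1)) _
  have e : ∀ n : ℕ, poissonWeight (lam * ℓ) n *
        (ℓ * (coverProbGiven ℓ (n + 1) r - coverProbGiven ℓ n r))
      = Real.exp (-(lam * ℓ)) * ℓ * ((lam * ℓ) ^ n / n.factorial * coverProbGiven ℓ (n + 1) r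
        - (lam * ℓ) ^ n / n.factorial * coverProbGiven ℓ n r) := by
    intro n; rw [poissonWeight]; ring
  simp_rw [e]
  rw [tsum_mul_left, hs1.tsum_sub hs0, hf]
  ring

lemma hasDerivAt_coverProb_r (hℓ : 0 < ℓ) (hlam : 0 ≤ lam) (hr : 0 < r) :
    HasDerivAt (fun s => coverProb ℓ lam s)
      (∑' n : ℕ, poissonWeight (lam * ℓ) n * coverProbGivenDeriv ℓ n r) r := by
  have hx : 0 ≤ lam * ℓ := by positivity
  have hpos : ∀ y ∈ Ioi (r / 2), 0 < y := fun y hy => (half_pos hr).trans hy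
  have hu : Summable fun n : ℕ => poissonWeight (lam * ℓ) n * (4 / r + 2 / r * n) :=
    summable_poissonWeight_mul (A := 4 / r) (B := 2 / r)
      (fun n => (abs_of_nonneg (by positivity)).le) _
  have hrI : r ∈ Ioi (r / 2) := half_lt_self hr
  have h := hasDerivAt_tsum_of_isPreconnected (t := Ioi (r / 2))
    (g := fun (n : ℕ) s => poissonWeight (lam * ℓ) n * coverProbGiven ℓ n s)
    (g' := fun (n : ℕ) s => poissonWeight (lam * ℓ) n * coverProbGivenDeriv ℓ n s)
    (y₀ := r) (y := r) hu isOpen_Ioi isPreconnected_Ioi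
    (fun n y hy => (hasDerivAt_coverProbGiven hℓ n (hpos y hy)).const_mul _)
    (fun n y hy => ?_) hrI ?_ hrI
  · refine h.congr_of_eventuallyEq ?_
    filter_upwards [lt_mem_nhds hr] with s hs
    exact coverProb_eq_tsum_poissonWeight hℓ hlam hs
  · have hy0 := hpos y hy
    have hw := poissonWeight_nonneg hx n
    have hd := coverProbGivenDeriv_nonneg (ℓ := ℓ) n hy0
    rw [Real.norm_of_nonneg (mul_nonneg hw hd)]
    refine mul_le_mul_of_nonneg_left ((coverProbGivenDeriv_le hℓ n hy0).trans ?_) hw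
    have h2 : (4 / r + 2 / r * n : ℝ) = (n + 2) / (r / 2) := by field_simp; ring
    rw [h2]
    have : r / 2 ≤ y := le_of_lt hy
    gcongr
  · exact summable_poissonWeight_mul (A := 1) (B := 0)
      (by simpa using fun n => abs_coverProbGiven_le_one hℓ n hr) _

lemma partialLam_eq (hℓ : 0 < ℓ) (hlam : 0 ≤ lam) (hr : 0 < r) :
    partialLam ℓ lam r = ∑' n : ℕ, poissonWeight (lam * ℓ) n *
        (ℓ * (coverProbGiven ℓ (n + 1) r - coverProbGiven ℓ n r)) :=
  (hasDerivWithinAt_coverProb_lam hℓ hlam hr).derivWithin (uniqueDiffOn_Ici 0 lam hlam)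

lemma partialR_eq (hℓ : 0 < ℓ) (hlam : 0 ≤ lam) (hr : 0 < r) :
    partialR ℓ lam r = ∑' n : ℕ, poissonWeight (lam * ℓ) n * coverProbGivenDeriv ℓ n r :=
  (hasDerivAt_coverProb_r hℓ hlam hr).deriv

lemma mul_coverProbGiven_sub_nonneg (hℓ : 0 < ℓ) (n : ℕ) (hr : 0 < r) :
    0 ≤ ℓ * (coverProbGiven ℓ (n + 1) r - coverProbGiven ℓ n r) :=
  mul_nonneg hℓ.le (sub_nonneg.2 (coverProbGiven_le_succ hℓ n hr))

lemma summable_partialLam (hℓ : 0 < ℓ) (hr : 0 < r) (x : ℝ) :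
    Summable fun n : ℕ => poissonWeight x n *
        (ℓ * (coverProbGiven ℓ (n + 1) r - coverProbGiven ℓ n r)) :=
  summable_poissonWeight_mul (A := r) (B := 0) (fun n => by
    rw [abs_of_nonneg (mul_coverProbGiven_sub_nonneg hℓ n hr), zero_mul, add_zero]
    exact mul_coverProbGiven_sub_le hℓ n hr) x

lemma summable_partialR (hℓ : 0 < ℓ) (hr : 0 < r) (x : ℝ) :
    Summable fun n : ℕ => poissonWeight x n * coverProbGivenDeriv ℓ n r :=
  summable_poissonWeight_mul (A := 2 / r) (B := 2 / ℓ) (fun n => by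
    rw [abs_of_nonneg (coverProbGivenDeriv_nonneg n hr), div_mul_eq_mul_div]
    exact coverProbGivenDeriv_le' hℓ n hr) x

lemma partialLam_pos (hℓ : 0 < ℓ) (hlam : 0 ≤ lam) (hr : 0 < r) : 0 < partialLam ℓ lam r := by
  have hx : 0 ≤ lam * ℓ := by positivity
  rw [partialLam_eq hℓ hlam hr]
  refine (summable_partialLam hℓ hr _).tsum_pos (fun n => mul_nonneg (poissonWeight_nonneg hx n)
    (mul_coverProbGiven_sub_nonneg hℓ n hr)) 0 ?_
  have h := sub_pos.2 (coverProbGiven_zero_lt_one hℓ hr)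
  have : 0 < poissonWeight (lam * ℓ) 0 := by simp [poissonWeight, Real.exp_pos]
  rw [zero_add]
  positivity

lemma partialLam_le (hℓ : 0 < ℓ) (hlam : 0 ≤ lam) (hr : 0 < r) : partialLam ℓ lam r ≤ r := by
  have hx : 0 ≤ lam * ℓ := by positivity
  have h := tsum_poissonWeight_mul_affine r 0 (lam * ℓ)
  simp only [zero_mul, add_zero] at h
  rw [partialLam_eq hℓ hlam hr]
  refine le_of_le_of_eq ?_ h
  refine (summable_partialLam hℓ hr _).tsum_le_tsum (fun n => ?_)
    (summable_poissonWeight_mul (g := fun _ => r) (A := |r|) (B := 0) (fun n => by simp) _)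
  exact mul_le_mul_of_nonneg_left (mul_coverProbGiven_sub_le hℓ n hr) (poissonWeight_nonneg hx n)

lemma partialR_le (hℓ : 0 < ℓ) (hlam : 0 ≤ lam) (hr : 0 < r) :
    partialR ℓ lam r ≤ 2 / r + 2 * lam := by
  have hx : 0 ≤ lam * ℓ := by positivity
  have h := tsum_poissonWeight_mul_affine (2 / r) (2 / ℓ) (lam * ℓ)
  have e : 2 / ℓ * (lam * ℓ) = 2 * lam := by field_simp
  rw [e] at h
  rw [partialR_eq hℓ hlam hr, ← h]
  refine (summable_partialR hℓ hr _).tsum_le_tsum (fun n => ?_)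
    (summable_poissonWeight_mul (A := 2 / r) (B := 2 / ℓ)
      (fun n => (abs_of_nonneg (by positivity)).le) _)
  rw [div_mul_eq_mul_div]
  exact mul_le_mul_of_nonneg_left (coverProbGivenDeriv_le' hℓ n hr) (poissonWeight_nonneg hx n)

lemma partialLam_le_partialR (hℓ : 0 < ℓ) (hlam : 0 ≤ lam) (hr : 0 < r) :
    partialLam ℓ lam r ≤ 2 * r ^ 2 * partialR ℓ lam r := by
  have hx : 0 ≤ lam * ℓ := by positivity
  rw [partialLam_eq hℓ hlam hr, partialR_eq hℓ hlam hr, ← tsum_mul_left]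
  refine (summable_partialLam hℓ hr _).tsum_le_tsum (fun n => ?_)
    ((summable_partialR hℓ hr _).mul_left _)
  rw [mul_left_comm (2 * r ^ 2)]
  exact mul_le_mul_of_nonneg_left (mul_coverProbGiven_sub_le_deriv hℓ n hr)
    (poissonWeight_nonneg hx n)

lemma partialR_pos (hℓ : 0 < ℓ) (hlam : 0 ≤ lam) (hr : 0 < r) : 0 < partialR ℓ lam r :=
  pos_of_mul_pos_right ((partialLam_pos hℓ hlam hr).trans_le (partialLam_le_partialR hℓ hlam hr))
    (by positivity)

end

end SegmentModel

theorem mainTheorem4 :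
    (∀ ℓ lam r : ℝ, 0 < ℓ → 0 ≤ lam → 0 < r →
      DifferentiableWithinAt ℝ (fun s => SegmentModel.coverProb ℓ s r) (Set.Ici 0) lam ∧
      DifferentiableAt ℝ (fun s => SegmentModel.coverProb ℓ lam s) r ∧
      0 < SegmentModel.partialLam ℓ lam r ∧
      0 < SegmentModel.partialR ℓ lam r) ∧
    (∀ lam r : ℝ, 0 ≤ lam → 0 < r →
      BddAbove ((fun ℓ => SegmentModel.partialLam ℓ lam r) '' Set.Ioi 0) ∧
      BddAbove ((fun ℓ => SegmentModel.partialR ℓ lam r) '' Set.Ioi 0)) ∧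
    ∃ C : ℝ → ℝ, ContinuousOn C (Set.Ioi 0) ∧ (∀ r : ℝ, 0 < r → 0 < C r) ∧
      ∀ ℓ lam r : ℝ, 0 < ℓ → 0 ≤ lam → 0 < r →
        SegmentModel.partialLam ℓ lam r ≤
          C r * Real.exp (lam * r / 2) * SegmentModel.partialR ℓ lam r := by
  refine ⟨fun ℓ lam r hℓ hlam hr => ⟨?_, ?_, ?_, ?_⟩, fun lam r hlam hr => ⟨?_, ?_⟩,
    fun r => 2 * r ^ 2, by fun_prop, fun r hr => by positivity, fun ℓ lam r hℓ hlam hr => ?_⟩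
  · exact (SegmentModel.hasDerivWithinAt_coverProb_lam hℓ hlam hr).differentiableWithinAt
  · exact (SegmentModel.hasDerivAt_coverProb_r hℓ hlam hr).differentiableAt
  · exact SegmentModel.partialLam_pos hℓ hlam hr
  · exact SegmentModel.partialR_pos hℓ hlam hr
  · refine ⟨r, ?_⟩
    rintro _ ⟨ℓ, hℓ, rfl⟩
    exact SegmentModel.partialLam_le hℓ hlam hr
  · refine ⟨2 / r + 2 * lam, ?_⟩
    rintro _ ⟨ℓ, hℓ, rfl⟩
    exact SegmentModel.partialR_le hℓ hlam hr
  · -- the bound holds without the exponential factor, which is at least `1`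
    have h1 : 1 ≤ Real.exp (lam * r / 2) := Real.one_le_exp (by positivity)
    have h2 := SegmentModel.partialR_pos hℓ hlam hr
    refine (SegmentModel.partialLam_le_partialR hℓ hlam hr).trans ?_
    refine mul_le_mul_of_nonneg_right ?_ h2.le
    exact le_mul_of_one_le_right (by positivity) h1
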